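/- Let $f:\mathbb R^{d_1}\times\mathbb R^{d_2}\to\mathbb R$ be $C^2$, write $z=(x,y)$ and $F=(\nabla_x f,-\nabla_y f)$, and assume that there is $L>0$ with $\|DF(z)\|\le L$ for all $z$ (operator norm for the Euclidean norm). Let $z^*$ be an equilibrium, i.e. $F(z^*)=0$, and suppose that $DF(z^*)$ is invertible. Put $$A=\nabla_{xx}^2f(z^*),\quad B=\nabla_{yy}^2f(z^*),\quad C=\nabla_{xy}^2f(z^*),\quad r=\operatorname{rank}B .$$ *Restricted Schur complement.* Let $\Gamma$ be the $d_1\times(d_2-r)$ matrix $CN$, where the columns of $N$ form an orthonormal basis of $\ker B$, and let $U$ be a matrix whose columns form an orthonormal basis of $(\operatorname{range}\Gamma)^\perp$. Then $S_r=U^\top(A-CB^\dagger C^\top)U$, with $B^\dagger$ the Moore–Penrose inverse; a $0\times0$ matrix counts as positive semidefinite. *Hemicurvatures.* For $\tau>0$ let $\Lambda_\tau=\operatorname{diag}(\tfrac1\tau I_{d_1},I_{d_2})$, $H_\tau=\Lambda_\tau DF(z^*)$ and $\varepsilon=1/\tau$. Consider the eigenvalue functions $\lambda_j(\varepsilon)$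 of $H_\tau$, $\varepsilon\to0+$, given for small $\varepsilon>0$ by convergent Puiseux series $\lambda_j(\varepsilon)=\sum_{k\ge1}\alpha_j^{(k)}\varepsilon^{k/p_j}$, for which $\lambda_j(\varepsilon)=\pm i\sigma_j\sqrt\varepsilon+o(\sqrt\varepsilon)$ with $\sigma_j$ a singular value of $\Gamma$ (one singular value for each column of $\Gamma$); let $\mathcal I$ be the set of their indices. If some $\alpha_j^{(k)}$ has nonzero real part, let $k_0$ be the smallest such $k$ and put $\varrho_j=k_0/p_j$, $\xi_j=\operatorname{Re}\alpha_j^{(k_0)}$; otherwise put $\varrho_j=1$, $\xi_j=0$. The hemicurvature is $$\iota_j=\lim_{\varepsilon\to0+}\frac{\xi_j\,\varepsilon^{\varrho_j-1}}{\sigma_j^2}\in[-\infty,\infty],$$ and $s_0=\max_{j\in\mathcal I}(-\iota_j)$, with $s_0=-\infty$ if $\mathcal I=\varnothing$. *Stability.* For $0<s<1/L$ and $\tau\ge1$, the continuous-time two-timescale extragradient ($\tau$-EG) flow is $$\dot z=\varphi_\tau(z):=-(I+s\Lambda_\tau DF(z))^{-1}\Lambda_\tau F(z).$$ The point $z^*$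 is a strict linearly stable point of it if $\varphi_\tau(z^*)=0$, $\varphi_\tau$ is differentiable at $z^*$, and all complex eigenvalues of $D\varphi_\tau(z^*)$ have negative real part. It is a strict linearly stable point of $\infty$-EG with step size $s$ if there is $\tau^\star$ (possibly depending on $s$) such that it is a strict linearly stable point of $\tau$-EG with step size $s$ for every $\tau>\tau^\star$. **Theorem.** Under these assumptions, $S_r\succeq0$, $B\preceq0$ and $s_0<1/L$ hold if and only if there is a constant $0<s^\star<1/L$ such that $z^*$ is a strict linearly stable point of $\infty$-EG for every step size $s\in(s^\star,1/L)$. -/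

import Mathlib

open Filter Topology

noncomputable section

namespace TwoTimescaleEG

/-- The space `ℝ^{d₁} × ℝ^{d₂}` of points `z = (x, y)` with its Euclidean norm: the coordinates
`Sum.inl i` are those of `x`, the coordinates `Sum.inr j` those of `y`. -/
abbrev Z (d₁ d₂ : ℕ) := EuclideanSpace ℝ (Fin d₁ ⊕ Fin d₂)

variable {d₁ d₂ : ℕ}

/-- The saddle gradient `F = (∇ₓ f, -∇_y f)`. -/
def saddleGrad (f : Z d₁ d₂ → ℝ) (z : Z d₁ d₂) : Z d₁ d₂ :=
  WithLp.toLp 2 (Sum.elim (fun i => gradient f z (Sum.inl i))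
    (fun j => -gradient f z (Sum.inr j)))

/-- The matrix of second partial derivatives of `f` at `z`. -/
def hessian (f : Z d₁ d₂ → ℝ) (z : Z d₁ d₂) :
    Matrix (Fin d₁ ⊕ Fin d₂) (Fin d₁ ⊕ Fin d₂) ℝ :=
  Matrix.of fun i j =>
    fderiv ℝ (fderiv ℝ f) z (EuclideanSpace.single i 1) (EuclideanSpace.single j 1)

/-- `A = ∇²ₓₓ f (z)`. -/
def hessXX (f : Z d₁ d₂ → ℝ) (z : Z d₁ d₂) : Matrix (Fin d₁) (Fin d₁) ℝ :=
  (hessian f z).toBlocks₁₁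

/-- `C = ∇²ₓ_y f (z)`. -/
def hessXY (f : Z d₁ d₂ → ℝ) (z : Z d₁ d₂) : Matrix (Fin d₁) (Fin d₂) ℝ :=
  (hessian f z).toBlocks₁₂

/-- `B = ∇²_yy f (z)`. -/
def hessYY (f : Z d₁ d₂ → ℝ) (z : Z d₁ d₂) : Matrix (Fin d₂) (Fin d₂) ℝ :=
  (hessian f z).toBlocks₂₂

/-! ### The restricted Schur complement -/

/-- The four Penrose equations: `X` is the Moore-Penrose inverse of the real matrix `M`. -/
structure IsMoorePenrose {m n : Type*} [Fintype m] [Fintype n]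
    (M : Matrix m n ℝ) (X : Matrix n m ℝ) : Prop where
  mul_mul_left : M * X * M = M
  mul_mul_right : X * M * X = X
  symm_left : (M * X).transpose = M * X
  symm_right : (X * M).transpose = X * M

theorem IsMoorePenrose.unique {m n : Type*} [Fintype m] [Fintype n]
    {M : Matrix m n ℝ} {X Y : Matrix n m ℝ}
    (hX : IsMoorePenrose M X) (hY : IsMoorePenrose M Y) : X = Y := by
  have h1 : M * X = M * Y := by
    calc M * X = (M * X).transpose := hX.symm_left.symm
      _ = ((M * Y) * (M * X)).transpose := by rw [← Matrix.mul_assoc, hY.mul_mul_left]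
      _ = (M * X) * (M * Y) := by rw [Matrix.transpose_mul, hX.symm_left, hY.symm_left]
      _ = M * Y := by rw [← Matrix.mul_assoc, hX.mul_mul_left]
  have h2 : X * M = Y * M := by
    calc X * M = (X * M).transpose := hX.symm_right.symm
      _ = ((X * M) * (Y * M)).transpose := by
          rw [Matrix.mul_assoc X M, ← Matrix.mul_assoc M Y M, hY.mul_mul_left]
      _ = (Y * M) * (X * M) := by rw [Matrix.transpose_mul, hX.symm_right, hY.symm_right]
      _ = Y * M := by rw [Matrix.mul_assoc Y M, ← Matrix.mul_assoc M X M, hX.mul_mul_left]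
  calc X = X * M * X := hX.mul_mul_right.symm
    _ = Y * (M * X) := by rw [h2, Matrix.mul_assoc]
    _ = Y := by rw [h1, ← Matrix.mul_assoc, hY.mul_mul_right]

/-- A real symmetric matrix has a Moore-Penrose inverse. -/
theorem exists_isMoorePenrose {n : Type*} [Fintype n] [DecidableEq n]
    {M : Matrix n n ℝ} (hM : M.IsHermitian) : ∃ X, IsMoorePenrose M X := by
  classical
  let P : Matrix n n ℝ := hM.eigenvectorUnitary
  let D : Matrix n n ℝ := Matrix.diagonal hM.eigenvalues
  let E : Matrix n n ℝ := Matrix.diagonal fun i => (hM.eigenvalues i)⁻¹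
  have hP : P.transpose * P = 1 := by
    have := Matrix.UnitaryGroup.star_mul_self hM.eigenvectorUnitary
    rwa [Matrix.star_eq_conjTranspose, Matrix.conjTranspose_eq_transpose_of_trivial] at this
  have hMD : M = P * D * P.transpose := by
    have := hM.spectral_theorem
    rw [Unitary.conjStarAlgAut_apply] at this
    simpa [P, D, Matrix.star_eq_conjTranspose, Function.comp_def] using this
  have key (S T : Matrix n n ℝ) :
      (P * S * P.transpose) * (P * T * P.transpose) = P * (S * T) * P.transpose := by
    calc _ = P * S * (P.transpose * P) * T * P.transpose := by simp only [Matrix.mul_assoc]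
      _ = _ := by rw [hP, Matrix.mul_one]; simp only [Matrix.mul_assoc]
  have hDE : D * E = E * D := by
    simp [D, E, Matrix.diagonal_mul_diagonal, mul_comm]
  have hDED : D * E * D = D := by
    simp [D, E, Matrix.diagonal_mul_diagonal]
  have hEDE : E * D * E = E := by
    simp only [D, E, Matrix.diagonal_mul_diagonal]
    congr 1
    funext i
    by_cases h : hM.eigenvalues i = 0 <;> simp [h]
  have hsym : (P * (D * E) * P.transpose).transpose = P * (D * E) * P.transpose := by
    rw [Matrix.transpose_mul, Matrix.transpose_mul, Matrix.transpose_transpose,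
      Matrix.mul_assoc]
    congr 2
    simp [D, E, Matrix.diagonal_mul_diagonal]
  refine ⟨P * E * P.transpose, ?_, ?_, ?_, ?_⟩
  · rw [hMD, key, key, hDED]
  · rw [hMD, key, key, hEDE]
  · rw [hMD, key, hsym]
  · rw [hMD, key, ← hDE, hsym]

/-- The Moore-Penrose inverse `M†`. -/
def pinv {m n : Type*} [Fintype m] [Fintype n] (M : Matrix m n ℝ) : Matrix n m ℝ :=
  Classical.epsilon (IsMoorePenrose M)

theorem IsMoorePenrose.pinv_eq {m n : Type*} [Fintype m] [Fintype n]
    {M : Matrix m n ℝ} {X : Matrix n m ℝ} (hX : IsMoorePenrose M X) : pinv M = X :=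
  (Classical.epsilon_spec (p := IsMoorePenrose M) ⟨X, hX⟩ : IsMoorePenrose M (pinv M)).unique hX

/-- A matrix whose columns form an orthonormal basis of the subspace `W`. -/
def orthoFrame {n : ℕ} (W : Submodule ℝ (EuclideanSpace ℝ (Fin n))) :
    Matrix (Fin n) (Fin (Module.finrank ℝ W)) ℝ :=
  Matrix.of fun i k => (stdOrthonormalBasis ℝ W k : EuclideanSpace ℝ (Fin n)) i

/-- The matrix `Γ` of the last `d₂ - rank B` columns of `C P`, where `B = P Δ Pᵀ` is an
orthogonal diagonalization with the nonzero eigenvalues first: these columns of `P` form an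
orthonormal basis of `ker B`. -/
def gammaBlock (B : Matrix (Fin d₂) (Fin d₂) ℝ) (C : Matrix (Fin d₁) (Fin d₂) ℝ) :
    Matrix (Fin d₁) (Fin (Module.finrank ℝ (LinearMap.ker (Matrix.toEuclideanLin B)))) ℝ :=
  C * orthoFrame (LinearMap.ker (Matrix.toEuclideanLin B))

/-- The orthogonal complement of the range of `Γ`. -/
def gammaPerp (B : Matrix (Fin d₂) (Fin d₂) ℝ) (C : Matrix (Fin d₁) (Fin d₂) ℝ) :
    Submodule ℝ (EuclideanSpace ℝ (Fin d₁)) :=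
  (LinearMap.range (Matrix.toEuclideanLin (gammaBlock B C)))ᗮ

/-- The restricted Schur complement `Uᵀ (A - C B† Cᵀ) U`, where the columns of `U` form an
orthonormal basis of `(range Γ)^⊥`. -/
def restrictedSchur (A : Matrix (Fin d₁) (Fin d₁) ℝ) (B : Matrix (Fin d₂) (Fin d₂) ℝ)
    (C : Matrix (Fin d₁) (Fin d₂) ℝ) :
    Matrix (Fin (Module.finrank ℝ (gammaPerp B C)))
      (Fin (Module.finrank ℝ (gammaPerp B C))) ℝ :=
  (orthoFrame (gammaPerp B C)).transpose * (A - C * pinv B * C.transpose) *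
    orthoFrame (gammaPerp B C)

/-- The singular values of `Γ`, one for each of its columns. -/
def gammaSingularValues (B : Matrix (Fin d₂) (Fin d₂) ℝ) (C : Matrix (Fin d₁) (Fin d₂) ℝ) :
    Set ℝ :=
  {σ | ∃ k < Module.finrank ℝ (LinearMap.ker (Matrix.toEuclideanLin B)),
    σ = (Matrix.toEuclideanLin (gammaBlock B C)).singularValues k}

/-! ### Timescale separation and the two-timescale EG flow -/

/-- `Λ_τ = diag(τ⁻¹ I, I)`. -/
def timescale (τ : ℝ) : Z d₁ d₂ →L[ℝ] Z d₁ d₂ :=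
  Matrix.toEuclideanCLM (n := Fin d₁ ⊕ Fin d₂) (𝕜 := ℝ)
    (Matrix.fromBlocks ((1 / τ) • (1 : Matrix (Fin d₁) (Fin d₁) ℝ)) 0 0 1)

/-- The set of all complex eigenvalues of a real endomorphism. -/
def complexSpectrum (T : Z d₁ d₂ →L[ℝ] Z d₁ d₂) : Set ℂ :=
  spectrum ℂ (((Matrix.toEuclideanCLM (n := Fin d₁ ⊕ Fin d₂) (𝕜 := ℝ)).symm T).map
    (algebraMap ℝ ℂ))

/-- The timescaled Jacobian `H_τ = Λ_τ DF(z)`. -/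
def timescaledJacobian (f : Z d₁ d₂ → ℝ) (τ : ℝ) (z : Z d₁ d₂) : Z d₁ d₂ →L[ℝ] Z d₁ d₂ :=
  timescale τ * fderiv ℝ (saddleGrad f) z

/-- The vector field of the two-timescale EG ODE,
`φ_τ(z) = -(I + s Λ_τ DF(z))⁻¹ Λ_τ F(z)`. -/
def egField (f : Z d₁ d₂ → ℝ) (s τ : ℝ) (z : Z d₁ d₂) : Z d₁ d₂ :=
  -((Ring.inverse (1 + s • (timescale τ * fderiv ℝ (saddleGrad f) z)) :
      Z d₁ d₂ →L[ℝ] Z d₁ d₂) (timescale τ (saddleGrad f z)))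

/-- `z` is a strict linearly stable equilibrium of `ż = φ(z)`: the field vanishes at `z`, and all
eigenvalues of its Jacobian at `z` have negative real parts. -/
def IsStrictLinearlyStable (φ : Z d₁ d₂ → Z d₁ d₂) (z : Z d₁ d₂) : Prop :=
  φ z = 0 ∧ DifferentiableAt ℝ φ z ∧ ∀ l ∈ complexSpectrum (fderiv ℝ φ z), l.re < 0

/-- Strict linear stability for `∞`-EG with step `s`: for `τ`-EG with all sufficiently large
`τ`. -/
def IsStableInftyEG (f : Z d₁ d₂ → ℝ) (s : ℝ) (z : Z d₁ d₂) : Prop :=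
  ∃ τstar : ℝ, ∀ τ > τstar, IsStrictLinearlyStable (egField f s τ) z

/-! ### Hemicurvatures -/

/-- `lam` is an eigenvalue function of `H_τ` in the parameter `ε = 1/τ` near `0+`. -/
def IsEigenvalueFunction (f : Z d₁ d₂ → ℝ) (z : Z d₁ d₂) (lam : ℝ → ℂ) : Prop :=
  ∀ᶠ ε in 𝓝[>] (0 : ℝ), lam ε ∈ complexSpectrum (timescaledJacobian f (1 / ε) z)

/-- The convergent Puiseux expansion `lam ε = ∑_{k ≥ 1} α k * ε ^ (k / p)` for small `ε > 0`. -/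
structure HasPuiseux (lam : ℝ → ℂ) (p : ℕ) (α : ℕ → ℂ) : Prop where
  pos : 0 < p
  coeff_zero : α 0 = 0
  hasSum : ∀ᶠ ε in 𝓝[>] (0 : ℝ),
    HasSum (fun k : ℕ => α k * ((ε ^ ((k : ℝ) / (p : ℝ)) : ℝ) : ℂ)) (lam ε)

/-- `ϱ` and `ξ` are the exponent and the coefficient of the leading term `ξ ε^ϱ` of the real part
of the Puiseux series; if the real part vanishes identically then `ϱ = 1` and `ξ = 0`. -/
def IsLeadingReal (p : ℕ) (α : ℕ → ℂ) (ϱ ξ : ℝ) : Prop :=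
  (∃ k₀ : ℕ, (α k₀).re ≠ 0 ∧ (∀ k < k₀, (α k).re = 0) ∧
    ϱ = (k₀ : ℝ) / (p : ℝ) ∧ ξ = (α k₀).re) ∨
  ((∀ k, (α k).re = 0) ∧ ϱ = 1 ∧ ξ = 0)

/-- `ι` is the hemicurvature `lim_{ε → 0+} ξ ε^(ϱ - 1) / σ²` (an extended real number) of one of
the eigenvalue functions of `H_τ` with `lam ε = ± i σ √ε + o(√ε)`, where `σ` is a singular value
of `Γ`. -/
def IsHemicurvature (f : Z d₁ d₂ → ℝ) (z : Z d₁ d₂) (ι : EReal) : Prop :=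
  ∃ (lam : ℝ → ℂ) (σ : ℝ) (p : ℕ) (α : ℕ → ℂ) (ϱ ξ : ℝ),
    IsEigenvalueFunction f z lam ∧
    σ ∈ gammaSingularValues (hessYY f z) (hessXY f z) ∧
    (Asymptotics.IsLittleO (𝓝[>] (0 : ℝ))
        (fun ε => lam ε - Complex.I * ((σ * √ε : ℝ) : ℂ)) (fun ε => √ε) ∨
      Asymptotics.IsLittleO (𝓝[>] (0 : ℝ))
        (fun ε => lam ε + Complex.I * ((σ * √ε : ℝ) : ℂ)) (fun ε => √ε)) ∧
    HasPuiseux lam p α ∧ IsLeadingReal p α ϱ ξ ∧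
    Tendsto (fun ε : ℝ => ((ξ * ε ^ (ϱ - 1) / σ ^ 2 : ℝ) : EReal)) (𝓝[>] 0) (𝓝 ι)

/-- `s₀ = max_j (-ι_j)`: the largest of the finitely many negated hemicurvatures, and `-∞` if
there are none. -/
def sZero (f : Z d₁ d₂ → ℝ) (z : Z d₁ d₂) : EReal :=
  sSup {t : EReal | ∃ ι : EReal, IsHemicurvature f z ι ∧ t = -ι}

end TwoTimescaleEG

end

/-! Put `ε = 1/τ`. Since `F(z*) = 0`, the Jacobian of the flow at `z*` is `-(I + sH)⁻¹H` with `H =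
H_τ`, and an eigenvalue `λ` of `H` yields the eigenvalue `-λ/(1 + sλ)`, whose real part has the sign
of `-(Re λ + s|λ|²)`. Stability therefore means that all eigenvalues of `[[εA, εC], [-Cᵀ, -B]]`
satisfy `Re λ + s|λ|² > 0` for small `ε > 0` (`isStableInftyEG_iff_eventuallyOutside`).

Necessity: a negative eigenvalue `μ` of `-B`, or `εν` with `ν < 0` an eigenvalue of `S_r`, is
approximated by true eigenvalues (`exists_root_nearby`). These violate the inequality, in the first
case because `s|μ| ≤ sL < 1`, in the second because `s|λ|²` is only `O(ε²)`. On a branch `λ ~ ±iσ√ε`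
one has `|λ|² ~ σ²ε`, and division by `σ²ε` shows `-ι ≤ s` (`IsHemicurvature.neg_le`). A single
stable `s < 1/L` thus gives all three conditions.

Sufficiency: if the inequality fails for arbitrarily small `ε`, Newton-Puiseux splits the
characteristic polynomial into finitely many analytic branches, and one of them fails infinitely
often. With `δ = √ε` and suitably rescaled unit eigenvectors, compactness gives `λ → 0`, `λ/δ → iω`
and `Re λ/δ² → θ = Re x*(A - CB†Cᵀ)x` with `θ + sω² ≤ 0` (`exists_limit_of_bad_eigenvalues`).
Invertibility and `S_r ⪰ 0` exclude `ω = 0`, so `|ω|` is a singular value of `Γ` and the branch has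
hemicurvature `θ/ω² ≤ -s`. Hence `s ≤ s₀`, and every positive `s` in `(s₀, 1/L)` is stable. -/

noncomputable section

namespace TwoTimescaleEG

variable {d₁ d₂ : ℕ}

/-! ### Newton-Puiseux theory for analytic families of polynomials -/

open Polynomial in
/-- A family of polynomials of bounded degree whose coefficients are analytic at `0`. -/
structure AnalyticFamily (n : ℕ) (F : ℂ → ℂ[X]) : Prop where
  coeff : ∀ k, AnalyticAt ℂ (fun t => (F t).coeff k) 0
  natDegree_le : ∀ t, (F t).natDegree ≤ n

namespace AnalyticFamily

open Polynomial

variable {n : ℕ} {F : ℂ → ℂ[X]}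

theorem of_coeff (n : ℕ) {c : ℕ → ℂ → ℂ} (hc : ∀ k, AnalyticAt ℂ (c k) 0) :
    AnalyticFamily n (fun t => ∑ k ∈ Finset.range (n + 1), C (c k t) * X ^ k) where
  coeff k := by
    simp only [finsetSum_coeff, coeff_C_mul_X_pow]
    refine Finset.analyticAt_fun_sum _ fun i _ => ?_
    split_ifs
    · exact hc i
    · exact analyticAt_const
  natDegree_le t := by
    refine natDegree_sum_le_of_forall_le _ _ fun i hi => (natDegree_C_mul_X_pow_le _ _).trans ?_
    have := Finset.mem_range.1 hi
    omega

theorem eval_eq (hF : AnalyticFamily n F) (t x : ℂ) :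
    (F t).eval x = ∑ k ∈ Finset.range (n + 1), (F t).coeff k * x ^ k :=
  eval_eq_sum_range' (Nat.lt_succ_of_le (hF.natDegree_le t)) x

theorem analyticAt_eval (hF : AnalyticFamily n F) {a : ℂ → ℂ} (ha : AnalyticAt ℂ a 0) :
    AnalyticAt ℂ (fun t => (F t).eval (a t)) 0 := by
  simp only [hF.eval_eq]
  exact Finset.analyticAt_fun_sum _ fun k _ => (hF.coeff k).mul (ha.pow k)

theorem hasseDeriv (hF : AnalyticFamily n F) (k : ℕ) :
    AnalyticFamily n (fun t => Polynomial.hasseDeriv k (F t)) where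
  coeff i := by
    simp only [hasseDeriv_coeff]
    exact analyticAt_const.mul (hF.coeff _)
  natDegree_le t := (natDegree_hasseDeriv_le _ _).trans ((Nat.sub_le _ _).trans (hF.natDegree_le t))

theorem taylor (hF : AnalyticFamily n F) {a : ℂ → ℂ} (ha : AnalyticAt ℂ a 0) :
    AnalyticFamily n (fun t => Polynomial.taylor (a t) (F t)) where
  coeff k := by
    simp only [taylor_coeff]
    exact (hF.hasseDeriv k).analyticAt_eval ha
  natDegree_le t := by simpa using hF.natDegree_le t

theorem analyticAt_comp_pow {c : ℂ → ℂ} (hc : AnalyticAt ℂ c 0) {q : ℕ} (hq : q ≠ 0) :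
    AnalyticAt ℂ (fun t => c (t ^ q)) 0 := by
  have : AnalyticAt ℂ c ((fun t : ℂ => t ^ q) 0) := by simpa [hq] using hc
  exact this.fun_comp (f := fun t : ℂ => t ^ q) (analyticAt_id.fun_pow q)

theorem comp_pow (hF : AnalyticFamily n F) {q : ℕ} (hq : q ≠ 0) :
    AnalyticFamily n (fun t => F (t ^ q)) where
  coeff k := analyticAt_comp_pow (hF.coeff k) hq
  natDegree_le _ := hF.natDegree_le _

theorem _root_.TwoTimescaleEG.tendsto_pow_zero {q : ℕ} (hq : q ≠ 0) :
    Tendsto (fun t : ℂ => t ^ q) (𝓝 0) (𝓝 0) := by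
  have : Continuous fun t : ℂ => t ^ q := by fun_prop
  simpa [hq] using this.tendsto 0

/-- A simple root of an analytic family persists analytically. -/
theorem exists_simple_root (hF : AnalyticFamily n F) (h0 : (F 0).coeff 0 = 0)
    (h1 : (F 0).coeff 1 ≠ 0) :
    ∃ a : ℂ → ℂ, AnalyticAt ℂ a 0 ∧ a 0 = 0 ∧ ∀ᶠ t in 𝓝 0, (F t).eval (a t) = 0 := by
  let f : ℂ × ℂ → ℂ := fun u => (F u.1).eval u.2
  have hf : AnalyticAt ℂ f (0, 0) := by
    simp only [f, hF.eval_eq]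
    refine Finset.analyticAt_fun_sum _ fun k _ => ?_
    exact ((hF.coeff k).fun_comp (f := Prod.fst) (g := fun t => (F t).coeff k)
      analyticAt_fst).mul (analyticAt_snd.pow k)
  -- The partial derivative in the root variable is multiplication by the coefficient of index 1,
  -- hence invertible; the implicit function theorem applies.
  have hd : fderiv ℂ f (0, 0) ∘L .inr ℂ ℂ ℂ =
      ((ContinuousLinearEquiv.unitsEquivAut ℂ (Units.mk0 _ h1) : ℂ ≃L[ℂ] ℂ) : ℂ →L[ℂ] ℂ) := by
    have h2 : HasFDerivAt (fun x : ℂ => f (0, x)) (fderiv ℂ f (0, 0) ∘L .inr ℂ ℂ ℂ) 0 := by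
      have := hf.differentiableAt.hasFDerivAt
      exact HasFDerivAt.comp (g := f) (f := fun x : ℂ => ((0 : ℂ), x)) 0 this
        (hasFDerivAt_prodMk_right 0 0)
    have h3 : HasDerivAt (fun x : ℂ => f (0, x)) ((F 0).coeff 1) 0 := by
      have := (F 0).hasDerivAt (0 : ℂ)
      rwa [← coeff_zero_eq_eval_zero, coeff_derivative, zero_add, Nat.cast_zero, zero_add,
        mul_one] at this
    ext
    rw [h2.unique h3.hasFDerivAt]
    simp
  have hinv : (fderiv ℂ f (0, 0) ∘L .inr ℂ ℂ ℂ).IsInvertible := by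
    rw [hd]; exact ContinuousLinearMap.isInvertible_equiv
  have cdf : ContDiffAt ℂ (⊤ : WithTop ℕ∞) f (0, 0) := hf.contDiffAt
  refine ⟨cdf.implicitFunction (by simp) hinv,
    (cdf.contDiffAt_implicitFunction (by simp) hinv).analyticAt,
    cdf.implicitFunction_apply_self (by simp) hinv, ?_⟩
  have := cdf.eventually_apply_implicitFunction (by simp) hinv
  simpa [f, ← coeff_zero_eq_eval_zero, h0] using this

/-- The Newton polygon step: the coefficients of index `< m` of `F (t ^ q)` are divisible by the
powers `t ^ (p * (m - k))` along an edge of slope `p / q`. -/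
theorem exists_newton_edge (hF : AnalyticFamily n F) {m : ℕ}
    (h0 : ∀ k < m, (F 0).coeff k = 0)
    (hne : ∃ k < m, ¬ ∀ᶠ t in 𝓝 0, (F t).coeff k = 0) :
    ∃ p q : ℕ, p ≠ 0 ∧ q ≠ 0 ∧ ∃ l < m, ∃ d : ℕ → ℂ → ℂ,
      (∀ k, AnalyticAt ℂ (d k) 0) ∧
      (∀ k, ∀ᶠ t in 𝓝 0, t ^ (p * m) * d k t = t ^ (p * k) * (F (t ^ q)).coeff k) ∧
      d m 0 = (F 0).coeff m ∧ (∀ k, m < k → d k 0 = 0) ∧ d l 0 ≠ 0 ∧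
      ∀ k < m, (∀ᶠ t in 𝓝 0, (F t).coeff k = 0) → d k 0 = 0 := by
  classical
  let ord : ℕ → ℕ := fun k => analyticOrderNatAt (fun t => (F t).coeff k) 0
  let S := (Finset.range m).filter fun k => ¬ ∀ᶠ t in 𝓝 0, (F t).coeff k = 0
  have hS : S.Nonempty := by
    obtain ⟨k, hk, h⟩ := hne
    exact ⟨k, by simp only [S, Finset.mem_filter, Finset.mem_range]; exact ⟨hk, h⟩⟩
  -- The edge of the Newton polygon issuing from the vertex `(m, 0)`: `l` minimizes `ord k / (m -
  -- k)`. The fraction `p/q = ord l / (m - l)` need not be reduced. The functions `d k` are the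
  -- coefficients after substituting `t ^ p * x` for `x` and dividing by `t ^ (p * m)`.
  obtain ⟨l, hlS, hl⟩ := Finset.exists_min_image S (fun k => (ord k : ℚ) / (m - k : ℕ)) hS
  have memS {k : ℕ} : k ∈ S ↔ k < m ∧ ¬ ∀ᶠ t in 𝓝 0, (F t).coeff k = 0 := by
    simp only [S, Finset.mem_filter, Finset.mem_range]
  have hlm := (memS.1 hlS).1
  have hfac : ∀ k ∈ S, ∃ h : ℂ → ℂ, AnalyticAt ℂ h 0 ∧ h 0 ≠ 0 ∧
      ∀ᶠ t in 𝓝 0, (F t).coeff k = t ^ ord k * h t := by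
    intro k hk
    obtain ⟨h, h1, h2, h3⟩ := ((hF.coeff k).analyticOrderAt_ne_top).1
      (by rw [Ne, analyticOrderAt_eq_top]; exact (memS.1 hk).2)
    exact ⟨h, h1, h2, by simpa [EventuallyEq] using h3⟩
  have hp : ord l ≠ 0 := by
    intro h
    obtain ⟨g, -, g0, hg⟩ := hfac l hlS
    have := hg.self_of_nhds
    rw [h0 l hlm, h] at this
    simp at this
    exact g0 this.symm
  have hq : m - l ≠ 0 := by omega
  refine ⟨ord l, m - l, hp, hq, l, hlm, ?_⟩
  have hslope : ∀ k ∈ S, ord l * (m - k) ≤ (m - l) * ord k := by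
    intro k hk
    have h1 : 0 < m - k := by have := (memS.1 hk).1; omega
    have h2 := hl k hk
    rw [div_le_div_iff₀ (by exact_mod_cast Nat.pos_of_ne_zero hq) (by exact_mod_cast h1)] at h2
    have h3 : ord l * (m - k) ≤ ord k * (m - l) := by exact_mod_cast h2
    linarith [mul_comm (ord k) (m - l)]
  have key : ∀ k, ∃ d : ℂ → ℂ, AnalyticAt ℂ d 0 ∧
      (∀ᶠ t in 𝓝 0, t ^ (ord l * m) * d t = t ^ (ord l * k) * (F (t ^ (m - l))).coeff k) ∧
      (k = m → d 0 = (F 0).coeff m) ∧ (m < k → d 0 = 0) ∧ (k = l → d 0 ≠ 0) ∧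
      (k < m → (∀ᶠ t in 𝓝 0, (F t).coeff k = 0) → d 0 = 0) := by
    intro k
    have hpow := (hF.comp_pow hq).coeff k
    rcases le_or_gt m k with hmk | hkm
    · refine ⟨fun t => t ^ (ord l * (k - m)) * (F (t ^ (m - l))).coeff k,
        (analyticAt_id.fun_pow _).mul hpow, ?_, ?_, ?_, ?_, ?_⟩
      · refine .of_forall fun t => ?_
        rw [← mul_assoc, ← pow_add, ← mul_add, Nat.add_sub_cancel' hmk]
      · rintro rfl; simp [hq]
      · intro h
        have : k - m ≠ 0 := by omega
        simp [hp, this]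
      · omega
      · omega
    · by_cases hk : k ∈ S
      · obtain ⟨h, h1, h2, h3⟩ := hfac k hk
        -- The exponent is a genuine difference by minimality of the slope (`hslope`), and it is
        -- zero for `k = l`, which is why `d l 0 ≠ 0`.
        refine ⟨fun t => t ^ ((m - l) * ord k - ord l * (m - k)) * h (t ^ (m - l)),
          (analyticAt_id.fun_pow _).mul (analyticAt_comp_pow h1 hq), ?_, by omega, by omega, ?_, ?_⟩
        · filter_upwards [(tendsto_pow_zero hq).eventually h3] with t ht
          have e1 : ord l * m = ord l * k + ord l * (m - k) := by
            rw [← mul_add, Nat.add_sub_cancel' hkm.le]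
          rw [ht, e1, pow_add, mul_assoc, ← mul_assoc (t ^ (ord l * (m - k))), ← pow_add,
            Nat.add_sub_cancel' (hslope k hk), pow_mul t (m - l)]
        · rintro rfl
          simpa [mul_comm, hq] using h2
        · intro _ h
          exact absurd h (memS.1 hk).2
      · have hz : ∀ᶠ t in 𝓝 0, (F t).coeff k = 0 := by
          by_contra h; exact hk (memS.2 ⟨hkm, h⟩)
        refine ⟨fun _ => 0, analyticAt_const, ?_, by omega, by simp, ?_, by simp⟩
        · filter_upwards [(tendsto_pow_zero hq).eventually hz] with t ht
          simp [ht]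
        · rintro rfl; exact absurd hlS hk
  choose d h1 h2 h3 h4 h5 h6 using key
  exact ⟨d, h1, h2, h3 m rfl, h4, h5 l rfl, h6⟩

/-- A polynomial of degree `m` with vanishing coefficient of index `m - 1` that is not a monomial
has a root of multiplicity less than `m`. -/
theorem _root_.TwoTimescaleEG.exists_root_low_multiplicity {P : ℂ[X]} {m l : ℕ}
    (hm : P.coeff (m + 1) ≠ 0)
    (hdeg : ∀ k, m + 1 < k → P.coeff k = 0) (hpm : P.coeff m = 0) (hl : l < m + 1)
    (hPl : P.coeff l ≠ 0) :
    ∃ b : ℂ, ∃ j, 1 ≤ j ∧ j < m + 1 ∧ (∀ k < j, (Polynomial.taylor b P).coeff k = 0) ∧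
      (Polynomial.taylor b P).coeff j ≠ 0 := by
  classical
  have hnd : P.natDegree = m + 1 :=
    natDegree_eq_of_le_of_coeff_ne_zero (natDegree_le_iff_coeff_eq_zero.2 fun k hk => hdeg k hk) hm
  obtain ⟨b, hb⟩ := IsAlgClosed.exists_root P (by
    rw [degree_eq_natDegree (by rintro rfl; simp at hm), hnd]; simp; norm_cast)
  have hex : ∃ j, (Polynomial.taylor b P).coeff j ≠ 0 := by
    by_contra! h
    have : Polynomial.taylor b P = 0 := Polynomial.ext (by simpa using h)
    rw [taylor_eq_zero] at this
    simp [this] at hm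
  refine ⟨b, Nat.find hex, ?_, ?_, fun k hk => not_not.1 (Nat.find_min hex hk), Nat.find_spec hex⟩
  · rw [Nat.one_le_iff_ne_zero]
    intro h
    have := Nat.find_spec hex
    rw [h, taylor_coeff_zero] at this
    exact this hb
  · by_contra! h
    -- A root of full multiplicity would give `P = c (X - b) ^ (m + 1)`; the vanishing coefficient
    -- of index `m` forces `b = 0`, so `P` would be a monomial.
    have hT : Polynomial.taylor b P = C (P.coeff (m + 1)) * X ^ (m + 1) := by
      ext k
      rw [coeff_C_mul_X_pow]
      split_ifs with hk
      · rw [hk, ← hnd, coeff_taylor_natDegree, leadingCoeff]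
      · rcases lt_or_gt_of_ne hk with hk | hk
        · exact not_not.1 (Nat.find_min hex (hk.trans_le h))
        · exact coeff_eq_zero_of_natDegree_lt (by rwa [natDegree_taylor, hnd])
    have hP : P = C (P.coeff (m + 1)) * (X + C (-b)) ^ (m + 1) := by
      have := congrArg (Polynomial.taylor (-b)) hT
      rw [taylor_taylor, neg_add_cancel, taylor_zero] at this
      refine this.trans ?_
      rw [taylor_apply, mul_comp, C_comp, X_pow_comp]
    have hb0 : b = 0 := by
      have := congrArg (fun Q => Q.coeff m) hP
      simp only [coeff_C_mul, coeff_X_add_C_pow, hpm] at this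
      simpa [hm, Nat.cast_add_one_ne_zero] using this.symm
    rw [hP, hb0] at hPl
    simp at hPl
    omega

/-- A multiple root of an analytic family continues to an analytic branch after a ramification
`t ↦ t ^ q` of the parameter. -/
theorem exists_puiseux_root (m : ℕ) (hm : 1 ≤ m) (hF : AnalyticFamily n F)
    (h0 : ∀ k < m, (F 0).coeff k = 0) (hFm : (F 0).coeff m ≠ 0) :
    ∃ q : ℕ, q ≠ 0 ∧ ∃ g : ℂ → ℂ, AnalyticAt ℂ g 0 ∧ g 0 = 0 ∧
      ∀ᶠ t in 𝓝 0, (F (t ^ q)).eval (g t) = 0 := by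
  induction m using Nat.strong_induction_on generalizing F with
  | _ m ih =>
  -- reduction to the case of a vanishing coefficient of index `m - 1`
  wlog hc : ∀ᶠ t in 𝓝 0, (F t).coeff (m - 1) = 0 generalizing F
  -- Tschirnhaus shift: the Hasse derivative of order `m - 1` has a simple root at `0`, since its
  -- coefficient of index 1 is `m` times that of index `m` in `F 0`. Translating by the continued
  -- root removes the coefficient of index `m - 1`.
  · obtain ⟨a, ha, ha0, haF⟩ := (hF.hasseDeriv (m - 1)).exists_simple_root
      (by rw [hasseDeriv_coeff]; simp [h0 (m - 1) (by omega)])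
      (by
        rw [hasseDeriv_coeff, Nat.add_sub_cancel' hm]
        exact mul_ne_zero (Nat.cast_ne_zero.2 (Nat.choose_pos (Nat.sub_le _ _)).ne') hFm)
    obtain ⟨q, hq, g, hg, hg0, hgF⟩ := this (hF.taylor ha) (by simpa [ha0] using h0)
      (by simpa [ha0] using hFm) (by simpa only [taylor_coeff] using haF)
    refine ⟨q, hq, fun t => g t + a (t ^ q), hg.add (analyticAt_comp_pow ha hq),
      by simp [hg0, hq, ha0], ?_⟩
    simpa only [taylor_eval] using hgF
  by_cases hne : ∃ k < m, ¬ ∀ᶠ t in 𝓝 0, (F t).coeff k = 0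
  swap
  · push Not at hne
    refine ⟨1, one_ne_zero, fun _ => 0, analyticAt_const, rfl, ?_⟩
    simpa [← coeff_zero_eq_eval_zero] using hne 0 hm
  obtain ⟨p, q, hp, hq, l, hl, d, hd, hdF, hdm, hdk, hdl, hdc⟩ := hF.exists_newton_edge h0 hne
  have hG := AnalyticFamily.of_coeff n hd
  set G : ℂ → ℂ[X] := fun t => ∑ k ∈ Finset.range (n + 1), C (d k t) * X ^ k with hGdef
  have hmn : m ≤ n := (le_natDegree_of_ne_zero hFm).trans (hF.natDegree_le 0)
  have hGc : ∀ k ≤ n, ∀ t, (G t).coeff k = d k t := by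
    intro k hk t
    simp only [hGdef, finsetSum_coeff, coeff_C_mul_X_pow]
    rw [Finset.sum_ite_eq, if_pos (Finset.mem_range.2 (by omega))]
  obtain ⟨j, rfl⟩ : ∃ j, m = j + 1 := ⟨m - 1, by omega⟩
  obtain ⟨b, i, hi1, him, hbi, hbn⟩ := exists_root_low_multiplicity (P := G 0) (m := j) (l := l)
    (by rwa [hGc _ hmn, hdm])
    (fun k hk => by
      rcases le_or_gt k n with hkn | hkn
      · rw [hGc k hkn, hdk k hk]
      · exact coeff_eq_zero_of_natDegree_lt ((hG.natDegree_le 0).trans_lt hkn))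
    (by rw [hGc j (by omega)]; exact hdc j (by omega) hc) hl (by rwa [hGc l (by omega)])
  -- The edge polynomial `G 0` has a root `b` of multiplicity `i < m`, so the induction hypothesis
  -- continues it; the substitution along the edge is then undone.
  obtain ⟨r, hr, g, hg, -, hgG⟩ := ih i him hi1 (hG.taylor (analyticAt_const (v := b))) hbi hbn
  refine ⟨r * q, mul_ne_zero hr hq, fun t => (t ^ r) ^ p * (g t + b),
    ((analyticAt_id.fun_pow r).fun_pow p).mul (hg.add analyticAt_const), by simp [hr, hp], ?_⟩
  have hall : ∀ᶠ t in 𝓝 (0 : ℂ), ∀ k ∈ Finset.range (n + 1),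
      t ^ (p * (j + 1)) * d k t = t ^ (p * k) * (F (t ^ q)).coeff k :=
    (Filter.eventually_all_finset _).2 fun k _ => hdF k
  filter_upwards [hgG, (tendsto_pow_zero hr).eventually hall] with t ht1 ht2
  rw [taylor_eval, hG.eval_eq] at ht1
  rw [hF.eval_eq, pow_mul]
  calc _ = ∑ k ∈ Finset.range (n + 1), (t ^ r) ^ (p * (j + 1)) *
        ((G (t ^ r)).coeff k * (g t + b) ^ k) := by
        refine Finset.sum_congr rfl fun k hk => ?_
        rw [hGc k (by have := Finset.mem_range.1 hk; omega), ← mul_assoc, ht2 k hk, mul_pow,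
          ← pow_mul]
        ring
    _ = 0 := by rw [← Finset.mul_sum, ht1, mul_zero]

/-- **Newton-Puiseux**: after a ramification of the parameter, a monic analytic family splits into
linear factors with analytic roots. -/
theorem exists_puiseux_factorization (hF : AnalyticFamily n F)
    (hmonic : ∀ t, (F t).Monic) (hdeg : ∀ t, (F t).natDegree = n) :
    ∃ q : ℕ, q ≠ 0 ∧ ∃ s : List (ℂ → ℂ), (∀ g ∈ s, AnalyticAt ℂ g 0) ∧
      ∀ᶠ t in 𝓝 0, F (t ^ q) = (s.map fun g => X - C (g t)).prod := by
  induction n generalizing F with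
  | zero =>
    refine ⟨1, one_ne_zero, [], by simp, .of_forall fun t => ?_⟩
    simpa using (hmonic _).natDegree_eq_zero.1 (hdeg _)
  | succ n ih =>
    classical
    obtain ⟨b, hb⟩ := IsAlgClosed.exists_root (F 0) (by
      rw [degree_eq_natDegree (hmonic 0).ne_zero, hdeg]; norm_cast)
    have hne : (Polynomial.taylor b (F 0)) ≠ 0 := by
      rw [Ne, taylor_eq_zero]; exact (hmonic 0).ne_zero
    have hex : ∃ j, (Polynomial.taylor b (F 0)).coeff j ≠ 0 := by
      by_contra! h
      exact hne (Polynomial.ext (by simpa using h))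
    have hj : 1 ≤ Nat.find hex := by
      rw [Nat.one_le_iff_ne_zero]
      intro h
      have := Nat.find_spec hex
      rw [h, taylor_coeff_zero] at this
      exact this hb
    obtain ⟨q, hq, g, hg, -, hgF⟩ := exists_puiseux_root (Nat.find hex) hj
      (hF.taylor (analyticAt_const (v := b))) (fun k hk => not_not.1 (Nat.find_min hex hk))
      (Nat.find_spec hex)
    simp only [taylor_eval] at hgF
    have hgb : AnalyticAt ℂ (fun t => g t + b) 0 := hg.add analyticAt_const
    let Q : ℂ → ℂ[X] := fun t => F (t ^ q) /ₘ (X - C (g t + b))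
    have hQd : ∀ t, (Q t).natDegree = n := fun t => by
      simp only [Q]
      rw [natDegree_divByMonic _ (monic_X_sub_C _), hdeg, natDegree_X_sub_C, Nat.add_sub_cancel]
    have hQm : ∀ t, (Q t).Monic := fun t => by
      have h1 := leadingCoeff_divByMonic_of_monic (p := F (t ^ q))
        (monic_X_sub_C (g t + b)) (by
          rw [degree_X_sub_C, degree_eq_natDegree (hmonic _).ne_zero, hdeg]
          norm_cast; omega)
      exact h1.trans (hmonic _)
    -- The coefficients of the quotient by `X - C a` are polynomial in `a` and the coefficients of
    -- the dividend, so the deflated family is again analytic.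
    have hQ : AnalyticFamily n Q :=
      { coeff := fun k => by
          simp only [Q, coeff_divByMonic_X_sub_C, hdeg]
          exact Finset.analyticAt_fun_sum _ fun i _ =>
            (hgb.fun_pow _).mul ((hF.comp_pow hq).coeff i)
        natDegree_le := fun t => (hQd t).le }
    obtain ⟨r, hr, s, hs, hsQ⟩ := ih hQ hQm hQd
    refine ⟨r * q, mul_ne_zero hr hq, (fun t => g (t ^ r) + b) :: s, ?_, ?_⟩
    · simp only [List.mem_cons, forall_eq_or_imp]
      exact ⟨analyticAt_comp_pow hgb hr, hs⟩
    · filter_upwards [hsQ, (tendsto_pow_zero hr).eventually hgF] with t ht1 ht2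
      rw [List.map_cons, List.prod_cons, ← ht1, pow_mul]
      exact (mul_divByMonic_eq_iff_isRoot.2 ht2).symm

end AnalyticFamily

/-! ### Eigenvalues and the EG field -/

theorem mem_spectrum_iff_exists_mulVec {n : Type*} [Fintype n] [DecidableEq n]
    (M : Matrix n n ℂ) (l : ℂ) :
    l ∈ spectrum ℂ M ↔ ∃ v : n → ℂ, v ≠ 0 ∧ M.mulVec v = l • v := by
  rw [spectrum.mem_iff, Matrix.isUnit_iff_isUnit_det, isUnit_iff_ne_zero, not_not,
    ← Matrix.exists_mulVec_eq_zero_iff]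
  refine exists_congr fun v => and_congr_right fun _ => ?_
  rw [Matrix.sub_mulVec, sub_eq_zero, Algebra.algebraMap_eq_smul_one, Matrix.smul_mulVec,
    Matrix.one_mulVec, eq_comm]

/-- The spectrum of `-(1 + s M)⁻¹ M` lies in the open left half-plane if and only if
`Re λ + s |λ|² > 0` for all eigenvalues `λ` of `M`. -/
theorem spectrum_neg_resolvent_re_neg_iff {n : Type*} [Fintype n] [DecidableEq n]
    {M N : Matrix n n ℂ} {s : ℝ} (h1 : (1 + (s : ℂ) • M) * N = 1)
    (h2 : N * (1 + (s : ℂ) • M) = 1) :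
    (∀ l ∈ spectrum ℂ (-(N * M)), l.re < 0) ↔
      ∀ l ∈ spectrum ℂ M, 0 < l.re + s * Complex.normSq l := by
  have hcomm : ∀ (l : ℂ) (v : n → ℂ), M.mulVec v = l • v →
      (1 + (s : ℂ) • M).mulVec v = (1 + s * l) • v := by
    intro l v h
    rw [Matrix.add_mulVec, Matrix.one_mulVec, Matrix.smul_mulVec, h, add_smul, one_smul, smul_smul]
  constructor
  · intro h l hl
    obtain ⟨v, hv, hMv⟩ := (mem_spectrum_iff_exists_mulVec M l).1 hl
    have h3 := hcomm l v hMv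
    have hNv : v = (1 + s * l) • N.mulVec v := by
      have := congrArg N.mulVec h3
      rwa [Matrix.mulVec_mulVec, h2, Matrix.one_mulVec, Matrix.mulVec_smul] at this
    have hne : (1 + s * l) ≠ 0 := by
      intro h0
      rw [h0, zero_smul] at hNv
      exact hv hNv
    -- Eigenvectors are shared, and `Re(-l/(1 + sl)) = -(Re l + s|l|²)/|1 + sl|²`.
    have hl' : -(l / (1 + s * l)) ∈ spectrum ℂ (-(N * M)) := by
      rw [mem_spectrum_iff_exists_mulVec]
      refine ⟨v, hv, ?_⟩
      rw [Matrix.neg_mulVec, ← Matrix.mulVec_mulVec, hMv, Matrix.mulVec_smul, neg_smul]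
      congr 1
      conv_rhs => rw [hNv, smul_smul, div_mul_cancel₀ _ hne]
    have h4 := h _ hl'
    have h5 : (-(l / (1 + s * l))).re =
        -((l.re + s * Complex.normSq l) / Complex.normSq (1 + s * l)) := by
      rw [Complex.neg_re, Complex.div_re]
      simp [Complex.normSq_apply]
      ring
    rw [h5, neg_lt_zero] at h4
    exact (div_pos_iff_of_pos_right (Complex.normSq_pos.2 hne)).1 h4
  · intro h l hl
    obtain ⟨v, hv, hv'⟩ := (mem_spectrum_iff_exists_mulVec _ l).1 hl
    have h3 : -(M.mulVec v) = l • v + (s * l) • M.mulVec v := by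
      have := congrArg (1 + (s : ℂ) • M).mulVec hv'
      rw [Matrix.neg_mulVec, Matrix.mulVec_neg, Matrix.mulVec_mulVec, ← Matrix.mul_assoc, h1,
        Matrix.one_mul, Matrix.mulVec_smul, Matrix.add_mulVec, Matrix.one_mulVec,
        Matrix.smul_mulVec, smul_add, smul_smul] at this
      rw [this, mul_comm (s : ℂ)]
    -- The map `l ↦ -l/(1 + sl)` is an involution, so the converse inverts it by the same formula.
    have h4 : (1 + s * l) • M.mulVec v = (-l) • v := by
      rw [add_smul, one_smul, neg_smul, eq_neg_iff_add_eq_zero]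
      have h3' := congrArg (fun w => M.mulVec v + w) h3
      simp only [add_neg_cancel] at h3'
      rw [h3']
      abel
    have hne : (1 + s * l) ≠ 0 := by
      intro h0
      rw [h0, zero_smul] at h4
      have hl0 : l = 0 := by simpa [hv] using h4.symm
      simp [hl0] at h0
    have hl' : -l / (1 + s * l) ∈ spectrum ℂ M := by
      rw [mem_spectrum_iff_exists_mulVec]
      refine ⟨v, hv, ?_⟩
      rw [div_eq_inv_mul, ← smul_smul, ← h4, smul_smul, inv_mul_cancel₀ hne, one_smul]
    have h5 := h _ hl'
    have hpos := Complex.normSq_pos.2 hne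
    have h6 : (-l / (1 + s * l)).re + s * Complex.normSq (-l / (1 + s * l)) =
        -l.re / Complex.normSq (1 + s * l) := by
      rw [Complex.normSq_div, Complex.div_re]
      simp [Complex.normSq_apply]
      ring
    rw [h6, div_pos_iff_of_pos_right hpos] at h5
    linarith

/-- If `T` is continuous at `z` and `G z = 0`, then `T G` is differentiable at `z`. -/
theorem hasFDerivAt_clm_apply_of_eq_zero {E : Type*} [NormedAddCommGroup E] [NormedSpace ℝ E]
    {T : E → E →L[ℝ] E} {G : E → E} {G' : E →L[ℝ] E} {z : E} (hT : ContinuousAt T z)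
    (hG : HasFDerivAt G G' z) (hz : G z = 0) :
    HasFDerivAt (fun w => T w (G w)) (T z ∘L G') z := by
  rw [hasFDerivAt_iff_isLittleO_nhds_zero] at hG ⊢
  simp only [hz, map_zero, sub_zero] at hG ⊢
  have hc : Tendsto (fun h => T (z + h)) (𝓝 0) (𝓝 (T z)) := by
    have : Tendsto (fun h => z + h) (𝓝 0) (𝓝 z) := by
      have h := (show Continuous fun h => z + h by fun_prop).tendsto 0
      rwa [add_zero] at h
    exact hT.tendsto.comp this
  have h1 : (fun h => T (z + h) (G (z + h) - G' h)) =o[𝓝 0] fun h => h := by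
    have hb : (fun h => T (z + h)) =O[𝓝 0] fun _ => (1 : ℝ) := hc.isBigO_one ℝ
    have : (fun h => T (z + h) (G (z + h) - G' h)) =O[𝓝 0]
        fun h => ‖T (z + h)‖ * ‖G (z + h) - G' h‖ :=
      Asymptotics.IsBigO.of_bound 1 (.of_forall fun h => by
        simpa using (T (z + h)).le_opNorm (G (z + h) - G' h))
    refine this.trans_isLittleO (Asymptotics.IsLittleO.of_norm_right ?_)
    simpa using hb.norm_left.mul_isLittleO hG.norm_norm
  have h2 : (fun h => (T (z + h) - T z) (G' h)) =o[𝓝 0] fun h => h := by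
    have hb : (fun h => T (z + h) - T z) =o[𝓝 0] fun _ => (1 : ℝ) := by
      rw [Asymptotics.isLittleO_one_iff]
      simpa using hc.sub_const (T z)
    have hG'O : (fun h => G' h) =O[𝓝 0] fun h : E => h := G'.isBigO_id _
    have : (fun h => (T (z + h) - T z) (G' h)) =O[𝓝 0]
        fun h => ‖T (z + h) - T z‖ * ‖G' h‖ :=
      Asymptotics.IsBigO.of_bound 1 (.of_forall fun h => by
        simpa using (T (z + h) - T z).le_opNorm (G' h))
    refine this.trans_isLittleO (Asymptotics.IsLittleO.of_norm_right ?_)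
    simpa using hb.norm_left.mul_isBigO hG'O.norm_norm
  refine (h1.add h2).congr_left fun h => ?_
  simp

/-! ### The Jacobian of the saddle gradient -/

/-- The matrix `[[ε A, ε C], [-Cᵀ, -B]]`. -/
def saddleMatrix (A : Matrix (Fin d₁) (Fin d₁) ℝ) (B : Matrix (Fin d₂) (Fin d₂) ℝ)
    (C : Matrix (Fin d₁) (Fin d₂) ℝ) (ε : ℝ) : Matrix (Fin d₁ ⊕ Fin d₂) (Fin d₁ ⊕ Fin d₂) ℝ :=
  Matrix.fromBlocks (ε • A) (ε • C) (-C.transpose) (-B)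

theorem hessian_isSymm {f : Z d₁ d₂ → ℝ} (hf : ContDiff ℝ 2 f) (z : Z d₁ d₂) :
    (hessian f z).IsSymm := by
  ext i j
  exact (hf.contDiffAt.isSymmSndFDerivAt (by simp)) _ _

theorem hessXX_isSymm {f : Z d₁ d₂ → ℝ} (hf : ContDiff ℝ 2 f) (z : Z d₁ d₂) :
    (hessXX f z).IsSymm := by
  ext i j
  exact (hessian_isSymm hf z).apply _ _

theorem hessYY_isSymm {f : Z d₁ d₂ → ℝ} (hf : ContDiff ℝ 2 f) (z : Z d₁ d₂) :
    (hessYY f z).IsSymm := by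
  ext i j
  exact (hessian_isSymm hf z).apply _ _

theorem gradient_apply (f : Z d₁ d₂ → ℝ) (z : Z d₁ d₂) (i : Fin d₁ ⊕ Fin d₂) :
    gradient f z i = fderiv ℝ f z (EuclideanSpace.single i 1) := by
  have h := InnerProductSpace.toDual_symm_apply (𝕜 := ℝ) (E := Z d₁ d₂)
    (x := EuclideanSpace.single i 1) (y := fderiv ℝ f z)
  rw [EuclideanSpace.inner_single_right] at h
  simpa [gradient] using h

/-- The sign of a coordinate in the saddle gradient. -/
def saddleSign (i : Fin d₁ ⊕ Fin d₂) : ℝ := Sum.elim (fun _ => 1) (fun _ => -1) i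

theorem saddleGrad_apply (f : Z d₁ d₂ → ℝ) (z : Z d₁ d₂) (i : Fin d₁ ⊕ Fin d₂) :
    saddleGrad f z i = saddleSign i * fderiv ℝ f z (EuclideanSpace.single i 1) := by
  rcases i with i | i <;> simp [saddleGrad, saddleSign, gradient_apply]

theorem contDiff_saddleGrad {f : Z d₁ d₂ → ℝ} (hf : ContDiff ℝ 2 f) :
    ContDiff ℝ 1 (saddleGrad f) := by
  have h1 : ContDiff ℝ 1 (fderiv ℝ f) := hf.fderiv_right (by norm_num)
  rw [contDiff_euclidean]
  intro i
  simp only [saddleGrad_apply]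
  exact contDiff_const.mul (h1.clm_apply contDiff_const)

theorem fderiv_saddleGrad {f : Z d₁ d₂ → ℝ} (hf : ContDiff ℝ 2 f) (z : Z d₁ d₂) :
    fderiv ℝ (saddleGrad f) z = Matrix.toEuclideanCLM (n := Fin d₁ ⊕ Fin d₂) (𝕜 := ℝ)
      (saddleMatrix (hessXX f z) (hessYY f z) (hessXY f z) 1) := by
  have h1 : ContDiff ℝ 1 (fderiv ℝ f) := hf.fderiv_right (by norm_num)
  have h2 : HasFDerivAt (fderiv ℝ f) (fderiv ℝ (fderiv ℝ f) z) z :=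
    (h1.differentiable (by norm_num) z).hasFDerivAt
  have h3 : HasFDerivAt (saddleGrad f) (fderiv ℝ (saddleGrad f) z) z :=
    ((contDiff_saddleGrad hf).differentiable (by norm_num) z).hasFDerivAt
  have h4 (v : Z d₁ d₂) (i : Fin d₁ ⊕ Fin d₂) : fderiv ℝ (saddleGrad f) z v i =
      saddleSign i * fderiv ℝ (fderiv ℝ f) z v (EuclideanSpace.single i 1) := by
    have h5 := (EuclideanSpace.proj (𝕜 := ℝ) i : Z d₁ d₂ →L[ℝ] ℝ).hasFDerivAt.comp z h3
    have h6 := (h2.clm_apply (hasFDerivAt_const (EuclideanSpace.single i (1 : ℝ)) z)).const_mul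
      (saddleSign i)
    have h7 : (EuclideanSpace.proj (𝕜 := ℝ) i : Z d₁ d₂ →L[ℝ] ℝ) ∘ saddleGrad f = fun w => saddleSign i * fderiv ℝ f w (EuclideanSpace.single i 1) := by
      funext w
      exact saddleGrad_apply f w i
    rw [h7] at h5
    simpa using congrArg (fun T => T v) (h5.unique h6)
  have h8 : ∀ i j, saddleMatrix (hessXX f z) (hessYY f z) (hessXY f z) 1 i j =
      saddleSign i * hessian f z j i := by
    rintro (i | i) (j | j) <;>
      simp [saddleMatrix, saddleSign, hessXX, hessYY, hessXY, Matrix.toBlocks₁₁,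
        Matrix.toBlocks₁₂, Matrix.toBlocks₂₂, (hessian_isSymm hf z).apply]
  ext v i
  rw [h4, Matrix.ofLp_toEuclideanCLM]
  have hv : v = ∑ j, v j • EuclideanSpace.single j (1 : ℝ) := by
    have := (EuclideanSpace.basisFun (Fin d₁ ⊕ Fin d₂) ℝ).sum_repr v
    simp only [EuclideanSpace.basisFun_repr, EuclideanSpace.basisFun_apply] at this
    exact this.symm
  conv_lhs => rw [hv]
  simp only [map_sum, map_smul, sum_apply, smul_apply,
    Matrix.mulVec, dotProduct, smul_eq_mul, Finset.mul_sum, h8]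
  refine Finset.sum_congr rfl fun j _ => ?_
  simp only [hessian, Matrix.of_apply]
  ring

theorem timescaledJacobian_eq {f : Z d₁ d₂ → ℝ} (hf : ContDiff ℝ 2 f) (z : Z d₁ d₂) (τ : ℝ) :
    timescaledJacobian f τ z = Matrix.toEuclideanCLM (n := Fin d₁ ⊕ Fin d₂) (𝕜 := ℝ)
      (saddleMatrix (hessXX f z) (hessYY f z) (hessXY f z) (1 / τ)) := by
  rw [timescaledJacobian, fderiv_saddleGrad hf, timescale, ← map_mul, saddleMatrix, saddleMatrix,
    Matrix.fromBlocks_multiply]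
  simp

theorem complexSpectrum_toEuclideanCLM (M : Matrix (Fin d₁ ⊕ Fin d₂) (Fin d₁ ⊕ Fin d₂) ℝ) :
    complexSpectrum (Matrix.toEuclideanCLM (n := Fin d₁ ⊕ Fin d₂) (𝕜 := ℝ) M) =
      spectrum ℂ (M.map (algebraMap ℝ ℂ)) := by
  rw [complexSpectrum, StarAlgEquiv.symm_apply_apply]

/-- For `τ ≥ 1` the timescale is a contraction, so the bound `L` on the Jacobian passes to `H_τ`. -/
theorem norm_timescale_le {τ : ℝ} (hτ : 1 ≤ τ) : ‖(timescale τ : Z d₁ d₂ →L[ℝ] Z d₁ d₂)‖ ≤ 1 := by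
  refine ContinuousLinearMap.opNorm_le_bound _ zero_le_one fun v => ?_
  rw [one_mul, EuclideanSpace.norm_eq, EuclideanSpace.norm_eq]
  refine Real.sqrt_le_sqrt (Finset.sum_le_sum fun i _ => ?_)
  rw [timescale, Matrix.ofLp_toEuclideanCLM, Matrix.fromBlocks_mulVec]
  have h1 : |τ⁻¹| ≤ 1 := by
    rw [abs_of_pos (by positivity)]
    exact inv_le_one_of_one_le₀ hτ
  rcases i with i | i
  · simp only [Sum.elim_inl, Matrix.smul_mulVec, Matrix.one_mulVec, Matrix.zero_mulVec, add_zero,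
      Pi.smul_apply, Function.comp, smul_eq_mul, one_div, norm_mul, mul_pow, Real.norm_eq_abs]
    refine mul_le_of_le_one_left (sq_nonneg _) (pow_le_one₀ (abs_nonneg _) h1)
  · simp [Function.comp]

/-- Only continuity of the resolvent factor is available, as `f` is merely `C²`. It suffices because
the saddle gradient vanishes at `z`: only the other factor is differentiated, and the Jacobian is
`-(1 + sH)⁻¹H`. The resolvent exists by a Neumann series, since `‖sH‖ ≤ sL < 1`. -/
theorem isStrictLinearlyStable_egField_iff {f : Z d₁ d₂ → ℝ} (hf : ContDiff ℝ 2 f) {L : ℝ}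
    {z : Z d₁ d₂} (hbound : ‖fderiv ℝ (saddleGrad f) z‖ ≤ L) (hz : saddleGrad f z = 0)
    {s τ : ℝ} (hs : 0 < s) (hsL : s * L < 1) (hτ : 1 ≤ τ) :
    IsStrictLinearlyStable (egField f s τ) z ↔
      ∀ l ∈ complexSpectrum (timescaledJacobian f τ z), 0 < l.re + s * Complex.normSq l := by
  have hF := contDiff_saddleGrad hf
  set H := timescaledJacobian f τ z with hH
  have hHL : ‖s • H‖ < 1 := by
    have h1 : ‖H‖ ≤ L := by
      refine (norm_mul_le _ _).trans ?_
      calc _ ≤ 1 * ‖fderiv ℝ (saddleGrad f) z‖ := by gcongr; exact norm_timescale_le hτ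
        _ ≤ L := by simpa using hbound
    rw [norm_smul, Real.norm_eq_abs, abs_of_pos hs]
    exact (mul_le_mul_of_nonneg_left h1 hs.le).trans_lt hsL
  have hunit : IsUnit (1 + s • H) := by
    have := isUnit_one_sub_of_norm_lt_one (x := -(s • H)) (by rwa [norm_neg])
    rwa [sub_neg_eq_add] at this
  have hT : ContinuousAt (fun w => Ring.inverse (1 + s • (timescale τ * fderiv ℝ (saddleGrad f) w)))
      z := by
    obtain ⟨u, hu⟩ := hunit
    have h1 := NormedRing.inverse_continuousAt u
    rw [hu] at h1
    have h2 : Continuous fun w => 1 + s • (timescale τ * fderiv ℝ (saddleGrad f) w) :=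
      continuous_const.add (continuous_const.mul (hF.continuous_fderiv (by norm_num)) |>.const_smul s)
    exact ContinuousAt.comp (f := fun w => 1 + s • (timescale τ * fderiv ℝ (saddleGrad f) w))
      h1 h2.continuousAt
  have hG : HasFDerivAt (fun w => timescale τ (saddleGrad f w)) H z :=
    (timescale τ).hasFDerivAt.comp z (hF.differentiable (by norm_num) z).hasFDerivAt
  have hφ : HasFDerivAt (egField f s τ) (-(Ring.inverse (1 + s • H) * H)) z :=
    (hasFDerivAt_clm_apply_of_eq_zero hT hG (by rw [hz, map_zero])).neg
  have hφ0 : egField f s τ z = 0 := by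
    rw [egField, hz, map_zero, map_zero, neg_zero]
  rw [IsStrictLinearlyStable, hφ.fderiv]
  simp only [hφ0, hφ.differentiableAt, true_and]
  let e := (Matrix.toEuclideanCLM (n := Fin d₁ ⊕ Fin d₂) (𝕜 := ℝ)).symm
  let m : Matrix (Fin d₁ ⊕ Fin d₂) (Fin d₁ ⊕ Fin d₂) ℝ →+*
    Matrix (Fin d₁ ⊕ Fin d₂) (Fin d₁ ⊕ Fin d₂) ℂ := (algebraMap ℝ ℂ).mapMatrix
  have hm1 : m (e (1 + s • H)) = 1 + (s : ℂ) • m (e H) := by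
    rw [map_add, map_one, map_add, map_one, map_smul]
    congr 1
    ext i j
    simp [m]
  have h1 : (1 + (s : ℂ) • m (e H)) * m (e (Ring.inverse (1 + s • H))) = 1 := by
    rw [← hm1, ← map_mul, ← map_mul, Ring.mul_inverse_cancel _ hunit, map_one, map_one]
  have h2 : m (e (Ring.inverse (1 + s • H))) * (1 + (s : ℂ) • m (e H)) = 1 := by
    rw [← hm1, ← map_mul, ← map_mul, Ring.inverse_mul_cancel _ hunit, map_one, map_one]
  have := spectrum_neg_resolvent_re_neg_iff h1 h2
  rw [← map_mul, ← map_mul, ← map_neg, ← map_neg] at this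
  exact this

theorem isStableInftyEG_iff {f : Z d₁ d₂ → ℝ} (hf : ContDiff ℝ 2 f) {L : ℝ}
    {z : Z d₁ d₂} (hbound : ‖fderiv ℝ (saddleGrad f) z‖ ≤ L) (hz : saddleGrad f z = 0)
    {s : ℝ} (hs : 0 < s) (hsL : s * L < 1) :
    IsStableInftyEG f s z ↔ ∀ᶠ ε in 𝓝[>] (0 : ℝ),
      ∀ l ∈ complexSpectrum (timescaledJacobian f (1 / ε) z),
        0 < l.re + s * Complex.normSq l := by
  have key : IsStableInftyEG f s z ↔ ∀ᶠ τ in atTop, ∀ l ∈ complexSpectrum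
      (timescaledJacobian f τ z), 0 < l.re + s * Complex.normSq l := by
    constructor
    · rintro ⟨T, hT⟩
      filter_upwards [eventually_gt_atTop T, eventually_ge_atTop 1] with τ h1 h2
      exact (isStrictLinearlyStable_egField_iff hf hbound hz hs hsL h2).1 (hT τ h1)
    · intro h
      obtain ⟨T, hT⟩ := eventually_atTop.1 (h.and (eventually_ge_atTop 1))
      exact ⟨T, fun τ hτ => (isStrictLinearlyStable_egField_iff hf hbound hz hs hsL
        (hT τ hτ.le).2).2 (hT τ hτ.le).1⟩
  rw [key]
  constructor
  · intro h
    simpa using tendsto_inv_nhdsGT_zero.eventually h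
  · intro h
    simpa using (tendsto_inv_atTop_nhdsGT_zero (𝕜 := ℝ)).eventually h

/-! ### Orthonormal frames, the restricted Schur complement and singular values -/

section LinearAlgebra

open scoped Matrix

theorem orthoFrame_mulVec {n : ℕ} (W : Submodule ℝ (EuclideanSpace ℝ (Fin n)))
    (c : Fin (Module.finrank ℝ W) → ℝ) :
    WithLp.toLp 2 (orthoFrame W *ᵥ c) =
      ((stdOrthonormalBasis ℝ W).repr.symm (WithLp.toLp 2 c) : EuclideanSpace ℝ (Fin n)) := by
  ext i
  rw [← OrthonormalBasis.sum_repr_symm]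
  simp [orthoFrame, Matrix.mulVec, dotProduct, mul_comm]

theorem orthoFrame_mulVec_mem {n : ℕ} (W : Submodule ℝ (EuclideanSpace ℝ (Fin n)))
    (c : Fin (Module.finrank ℝ W) → ℝ) : WithLp.toLp 2 (orthoFrame W *ᵥ c) ∈ W := by
  rw [orthoFrame_mulVec]
  exact Submodule.coe_mem _

theorem exists_orthoFrame_mulVec_eq {n : ℕ} {W : Submodule ℝ (EuclideanSpace ℝ (Fin n))}
    {v : Fin n → ℝ} (hv : WithLp.toLp 2 v ∈ W) : ∃ c, orthoFrame W *ᵥ c = v := by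
  refine ⟨((stdOrthonormalBasis ℝ W).repr ⟨_, hv⟩).ofLp, ?_⟩
  have := orthoFrame_mulVec W ((stdOrthonormalBasis ℝ W).repr ⟨_, hv⟩).ofLp
  simp only [WithLp.toLp_ofLp, LinearIsometryEquiv.symm_apply_apply] at this
  exact WithLp.toLp_injective 2 this

theorem orthoFrame_transpose_mul_self {n : ℕ} (W : Submodule ℝ (EuclideanSpace ℝ (Fin n))) :
    (orthoFrame W)ᵀ * orthoFrame W = 1 := by
  ext i j
  have := (stdOrthonormalBasis ℝ W).inner_eq_ite j i
  rw [Submodule.coe_inner, EuclideanSpace.inner_eq_star_dotProduct] at this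
  rw [Matrix.one_apply, Matrix.mul_apply]
  simp only [eq_comm (a := i)]
  rw [← this]
  simp [orthoFrame, dotProduct]

theorem orthoFrame_transpose_mulVec_eq_zero_iff {n : ℕ}
    (W : Submodule ℝ (EuclideanSpace ℝ (Fin n))) (v : Fin n → ℝ) :
    (orthoFrame W)ᵀ *ᵥ v = 0 ↔ WithLp.toLp 2 v ∈ Wᗮ := by
  rw [Submodule.mem_orthogonal]
  constructor
  · intro h u hu
    obtain ⟨c, hc⟩ := exists_orthoFrame_mulVec_eq (v := u.ofLp) hu
    rw [EuclideanSpace.inner_eq_star_dotProduct, ← hc, star_trivial, Matrix.dotProduct_mulVec,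
      ← Matrix.mulVec_transpose, h, zero_dotProduct]
  · intro h
    rw [← dotProduct_self_eq_zero]
    have h1 := h _ (orthoFrame_mulVec_mem W ((orthoFrame W)ᵀ *ᵥ v))
    rw [EuclideanSpace.inner_eq_star_dotProduct, star_trivial, Matrix.dotProduct_mulVec,
      ← Matrix.mulVec_transpose] at h1
    exact h1

theorem toLp_mem_ker_toEuclideanLin_iff {m n : ℕ} (M : Matrix (Fin m) (Fin n) ℝ) (v : Fin n → ℝ) :
    WithLp.toLp 2 v ∈ LinearMap.ker (Matrix.toEuclideanLin M) ↔ M *ᵥ v = 0 := by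
  rw [LinearMap.mem_ker, Matrix.toLpLin_toLp]
  exact WithLp.toLp_eq_zero 2

variable {A : Matrix (Fin d₁) (Fin d₁) ℝ} {B : Matrix (Fin d₂) (Fin d₂) ℝ}
  {C : Matrix (Fin d₁) (Fin d₂) ℝ}

theorem isMoorePenrose_pinv (hB : B.IsSymm) : IsMoorePenrose B (pinv B) := by
  obtain ⟨X, hX⟩ := exists_isMoorePenrose (M := B) (by
    rwa [Matrix.IsHermitian, Matrix.conjTranspose_eq_transpose_of_trivial])
  rwa [hX.pinv_eq]

theorem pinv_isSymm (hB : B.IsSymm) : (pinv B).IsSymm := by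
  have h := isMoorePenrose_pinv hB
  have hB' : Bᵀ = B := hB
  refine IsMoorePenrose.unique (M := B) ⟨?_, ?_, ?_, ?_⟩ h
  · have := congrArg Matrix.transpose h.mul_mul_left
    simpa [Matrix.transpose_mul, hB', Matrix.mul_assoc] using this
  · have := congrArg Matrix.transpose h.mul_mul_right
    simpa [Matrix.transpose_mul, hB', Matrix.mul_assoc] using this
  · have := h.symm_right
    rw [Matrix.transpose_mul, hB'] at this
    rw [this]
    exact h.symm_right
  · have := h.symm_left
    rw [Matrix.transpose_mul, hB'] at this
    rw [this]
    exact h.symm_left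

theorem pinv_mul_comm (hB : B.IsSymm) : pinv B * B = B * pinv B := by
  have := (isMoorePenrose_pinv hB).symm_left
  rwa [Matrix.transpose_mul, (pinv_isSymm hB).eq, hB.eq] at this

/-- The form in which invertibility of the Jacobian is used: the signs in the lower block do not
affect the kernel. -/
theorem saddleMatrix_kernel (hJ : (saddleMatrix A B C 1).det ≠ 0) {x : Fin d₁ → ℝ}
    {y : Fin d₂ → ℝ} (h1 : A *ᵥ x + C *ᵥ y = 0) (h2 : Cᵀ *ᵥ x + B *ᵥ y = 0) : x = 0 ∧ y = 0 := by
  by_contra h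
  refine hJ (Matrix.exists_mulVec_eq_zero_iff.1 ⟨Sum.elim x y, ?_, ?_⟩)
  · intro h0
    exact h ⟨funext fun i => congrFun h0 (Sum.inl i), funext fun i => congrFun h0 (Sum.inr i)⟩
  · rw [saddleMatrix, Matrix.fromBlocks_mulVec]
    simp only [Sum.elim_comp_inl, Sum.elim_comp_inr, one_smul, h1, Matrix.neg_mulVec]
    rw [← neg_add, h2]
    ext (i | i) <;> simp

/-- Frees `range Γ = C (ker B)` from the chosen basis of `ker B`. -/
theorem mem_range_gammaBlock_iff (v : Fin d₁ → ℝ) :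
    WithLp.toLp 2 v ∈ LinearMap.range (Matrix.toEuclideanLin (gammaBlock B C)) ↔
      ∃ y, B *ᵥ y = 0 ∧ C *ᵥ y = v := by
  constructor
  · rintro ⟨c, hc⟩
    refine ⟨orthoFrame (LinearMap.ker (Matrix.toEuclideanLin B)) *ᵥ c.ofLp,
      (toLp_mem_ker_toEuclideanLin_iff _ _).1 (orthoFrame_mulVec_mem _ _), ?_⟩
    rw [Matrix.mulVec_mulVec]
    exact congrArg WithLp.ofLp hc
  · rintro ⟨y, hy, rfl⟩
    obtain ⟨c, rfl⟩ := exists_orthoFrame_mulVec_eq ((toLp_mem_ker_toEuclideanLin_iff _ _).2 hy)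
    refine ⟨WithLp.toLp 2 c, ?_⟩
    rw [Matrix.mulVec_mulVec]
    rfl

/-- Orthogonality of `x` to `C (ker B)` means `Cᵀx ⊥ ker B`, that is, `Cᵀx ∈ range B` by symmetry,
and `B B†` is the orthogonal projector onto `range B`. -/
theorem mem_gammaPerp_iff (hB : B.IsSymm) (x : Fin d₁ → ℝ) :
    WithLp.toLp 2 x ∈ gammaPerp B C ↔ (B * pinv B) *ᵥ (Cᵀ *ᵥ x) = Cᵀ *ᵥ x := by
  have hX := isMoorePenrose_pinv hB
  rw [gammaPerp, Submodule.mem_orthogonal]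
  constructor
  · intro h
    set r := Cᵀ *ᵥ x - (B * pinv B) *ᵥ (Cᵀ *ᵥ x) with hr
    have hBr : B *ᵥ r = 0 := by
      rw [hr, Matrix.mulVec_sub, Matrix.mulVec_mulVec (M := B) (N := B * pinv B),
        ← pinv_mul_comm hB, ← Matrix.mul_assoc, hX.mul_mul_left, sub_self]
    have h1 : r ⬝ᵥ (Cᵀ *ᵥ x) = 0 := by
      have := h _ ((mem_range_gammaBlock_iff (B := B) (C := C) _).2 ⟨r, hBr, rfl⟩)
      rw [EuclideanSpace.inner_eq_star_dotProduct, star_trivial] at this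
      rw [Matrix.dotProduct_mulVec, Matrix.vecMul_transpose, dotProduct_comm]
      simpa using this
    have h2 : r ⬝ᵥ ((B * pinv B) *ᵥ (Cᵀ *ᵥ x)) = 0 := by
      rw [← Matrix.mulVec_mulVec, Matrix.dotProduct_mulVec, ← Matrix.mulVec_transpose, hB.eq, hBr,
        zero_dotProduct]
    have h3 : r ⬝ᵥ r = 0 := by
      conv_lhs => rw [hr]
      rw [← hr, sub_dotProduct, dotProduct_comm, h1, dotProduct_comm, h2, sub_zero]
    exact (sub_eq_zero.1 (dotProduct_self_eq_zero.1 h3)).symm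
  · rintro h u hu
    obtain ⟨y, hy, hyu⟩ := (mem_range_gammaBlock_iff (B := B) (C := C) u.ofLp).1 hu
    rw [EuclideanSpace.inner_eq_star_dotProduct, star_trivial, ← hyu, Matrix.dotProduct_mulVec,
      ← Matrix.mulVec_transpose, ← h, ← Matrix.mulVec_mulVec, dotProduct_comm,
      Matrix.dotProduct_mulVec, ← Matrix.mulVec_transpose, hB.eq, hy, zero_dotProduct]

theorem restrictedSchur_isHermitian (hA : A.IsSymm) (hB : B.IsSymm) :
    (restrictedSchur A B C).IsHermitian := by
  rw [Matrix.IsHermitian, Matrix.conjTranspose_eq_transpose_of_trivial, restrictedSchur]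
  simp only [Matrix.transpose_mul, Matrix.transpose_sub, Matrix.transpose_transpose, hA.eq,
    (pinv_isSymm hB).eq, Matrix.mul_assoc]

/-- An eigenvector of the restricted Schur complement lifts to a solution of the full system. -/
theorem exists_lift_of_restrictedSchur_eigenvector (hB : B.IsSymm) {ν : ℝ}
    {u : Fin (Module.finrank ℝ (gammaPerp B C)) → ℝ} (hu : restrictedSchur A B C *ᵥ u = ν • u) :
    ∃ w, A *ᵥ (orthoFrame (gammaPerp B C) *ᵥ u) + C *ᵥ w = ν • (orthoFrame (gammaPerp B C) *ᵥ u) ∧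
      Cᵀ *ᵥ (orthoFrame (gammaPerp B C) *ᵥ u) + B *ᵥ w = 0 := by
  set x := orthoFrame (gammaPerp B C) *ᵥ u with hx
  have h1 : (orthoFrame (gammaPerp B C))ᵀ *ᵥ
      ((A - C * pinv B * Cᵀ) *ᵥ x - ν • x) = 0 := by
    rw [Matrix.mulVec_sub, Matrix.mulVec_smul, hx, Matrix.mulVec_mulVec, Matrix.mulVec_mulVec,
      Matrix.mulVec_mulVec, orthoFrame_transpose_mul_self, Matrix.one_mulVec, ← hu, sub_eq_zero,
      restrictedSchur, Matrix.mul_assoc]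
  -- The residual is orthogonal to `(range Γ)ᗮ`, so it equals `C y` with `y ∈ ker B`; this `y` can
  -- be absorbed into `w` without disturbing the second equation.
  rw [orthoFrame_transpose_mulVec_eq_zero_iff, gammaPerp, Submodule.orthogonal_orthogonal,
    mem_range_gammaBlock_iff] at h1
  obtain ⟨y, hy, hCy⟩ := h1
  have h2 := (mem_gammaPerp_iff (C := C) hB x).1 (orthoFrame_mulVec_mem _ _)
  clear_value x
  refine ⟨-(pinv B *ᵥ (Cᵀ *ᵥ x)) - y, ?_, ?_⟩
  · rw [Matrix.mulVec_sub, hCy, Matrix.sub_mulVec]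
    simp only [Matrix.mulVec_neg, Matrix.mulVec_mulVec, Matrix.mul_assoc]
    abel
  · rw [Matrix.mulVec_sub, hy, Matrix.mulVec_neg,
      Matrix.mulVec_mulVec (M := B) (N := pinv B), h2]
    abel

/-- Semidefiniteness upgrades to definiteness: a zero of the form is a kernel vector of the
restricted Schur complement, which lifts to a kernel vector of the Jacobian. -/
theorem schur_pos_of_posSemidef (hB : B.IsSymm) (hJ : (saddleMatrix A B C 1).det ≠ 0)
    (hS : (restrictedSchur A B C).PosSemidef) {x : Fin d₁ → ℝ}
    (hx : (B * pinv B) *ᵥ (Cᵀ *ᵥ x) = Cᵀ *ᵥ x) :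
    0 ≤ x ⬝ᵥ ((A - C * pinv B * Cᵀ) *ᵥ x) ∧
      (x ⬝ᵥ ((A - C * pinv B * Cᵀ) *ᵥ x) = 0 → x = 0) := by
  obtain ⟨u, rfl⟩ := exists_orthoFrame_mulVec_eq ((mem_gammaPerp_iff hB x).2 hx)
  have h1 : (orthoFrame (gammaPerp B C) *ᵥ u) ⬝ᵥ
      ((A - C * pinv B * Cᵀ) *ᵥ (orthoFrame (gammaPerp B C) *ᵥ u)) =
      star u ⬝ᵥ (restrictedSchur A B C *ᵥ u) := by
    rw [star_trivial, restrictedSchur, ← Matrix.mulVec_mulVec, ← Matrix.mulVec_mulVec,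
      Matrix.dotProduct_mulVec u, Matrix.vecMul_transpose]
  rw [h1]
  refine ⟨hS.dotProduct_mulVec_nonneg u, fun h => ?_⟩
  rw [hS.dotProduct_mulVec_zero_iff] at h
  obtain ⟨w, hw1, hw2⟩ := exists_lift_of_restrictedSchur_eigenvector (A := A) (C := C) (ν := 0)
    (u := u) hB (by rw [h, zero_smul])
  rw [zero_smul] at hw1
  exact (saddleMatrix_kernel hJ hw1 hw2).1

/-- A negative eigenvalue of the restricted Schur complement is a root of
`det [[A - ν, C], [-Cᵀ, -B]]`. -/
theorem exists_neg_root_of_not_posSemidef (hA : A.IsSymm) (hB : B.IsSymm)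
    (hS : ¬ (restrictedSchur A B C).PosSemidef) :
    ∃ ν < 0, ∃ x w, x ≠ 0 ∧ A *ᵥ x + C *ᵥ w = (ν : ℝ) • x ∧ Cᵀ *ᵥ x + B *ᵥ w = 0 := by
  have hH := restrictedSchur_isHermitian (C := C) hA hB
  rw [hH.posSemidef_iff_eigenvalues_nonneg, Pi.le_def] at hS
  push Not at hS
  obtain ⟨i, hi⟩ := hS
  obtain ⟨w, hw⟩ := exists_lift_of_restrictedSchur_eigenvector hB (hH.mulVec_eigenvectorBasis i)
  refine ⟨_, hi, _, w, ?_, hw⟩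
  intro h0
  have := congrArg ((orthoFrame (gammaPerp B C))ᵀ *ᵥ ·) h0
  simp only [Matrix.mulVec_mulVec, orthoFrame_transpose_mul_self, Matrix.one_mulVec,
    Matrix.mulVec_zero] at this
  exact hH.eigenvectorBasis.orthonormal.ne_zero i (by ext k; exact congrFun this k)

/-- `Γ` is injective: `y ∈ ker B` with `Cy = 0` would put `(0, y)` in the kernel of the Jacobian. -/
theorem gammaSingularValues_pos (hJ : (saddleMatrix A B C 1).det ≠ 0) {σ : ℝ}
    (hσ : σ ∈ gammaSingularValues B C) : 0 < σ := by
  obtain ⟨k, hk, rfl⟩ := hσ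
  refine (LinearMap.injective_iff_forall_lt_finrank_singularValues_pos _).1 ?_ k (by simpa using hk)
  rw [← LinearMap.ker_eq_bot, LinearMap.ker_eq_bot']
  intro c hc
  have h1 : C *ᵥ (orthoFrame (LinearMap.ker (Matrix.toEuclideanLin B)) *ᵥ c.ofLp) = 0 := by
    rw [Matrix.mulVec_mulVec]
    exact congrArg WithLp.ofLp hc
  have h2 := (toLp_mem_ker_toEuclideanLin_iff B _).1 (orthoFrame_mulVec_mem _ c.ofLp)
  have h3 := (saddleMatrix_kernel hJ (x := 0)
    (by rw [Matrix.mulVec_zero, zero_add]; exact h1)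
    (by rw [Matrix.mulVec_zero, zero_add]; exact h2)).2
  have := congrArg ((orthoFrame (LinearMap.ker (Matrix.toEuclideanLin B)))ᵀ *ᵥ ·) h3
  simp only [Matrix.mulVec_mulVec, orthoFrame_transpose_mul_self, Matrix.one_mulVec,
    Matrix.mulVec_zero] at this
  ext i
  exact congrFun this i

/-- As `1 - B B†` projects onto `ker B`, the hypothesis is the eigenvalue equation `ΓᵀΓ c = ω² c` in
the coordinates of the frame. -/
theorem abs_mem_gammaSingularValues (hB : B.IsSymm) {ω : ℝ} {y : Fin d₂ → ℝ} (hy : y ≠ 0)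
    (hBy : B *ᵥ y = 0)
    (hCy : (1 - B * pinv B) *ᵥ (Cᵀ *ᵥ (C *ᵥ y)) = ω ^ 2 • y) :
    |ω| ∈ gammaSingularValues B C := by
  obtain ⟨c, rfl⟩ := exists_orthoFrame_mulVec_eq ((toLp_mem_ker_toEuclideanLin_iff B _).2 hBy)
  set N := orthoFrame (LinearMap.ker (Matrix.toEuclideanLin B)) with hN
  have hNB : Nᵀ * B = 0 := by
    have : B * N = 0 := by
      ext i j
      have := (toLp_mem_ker_toEuclideanLin_iff B _).1 (orthoFrame_mulVec_mem _ (Pi.single j 1))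
      rw [Matrix.mulVec_mulVec, Matrix.mulVec_single_one] at this
      exact congrFun this i
    have := congrArg Matrix.transpose this
    rwa [Matrix.transpose_mul, hB.eq, Matrix.transpose_zero] at this
  have hΓ : (gammaBlock B C)ᵀ *ᵥ (gammaBlock B C *ᵥ c) = ω ^ 2 • c := by
    have h1 := congrArg (Nᵀ *ᵥ ·) hCy
    simp only [Matrix.mulVec_smul, Matrix.mulVec_mulVec, orthoFrame_transpose_mul_self, hN,
      Matrix.one_mulVec] at h1
    rw [← hN] at h1
    rw [← h1, Matrix.mulVec_mulVec, gammaBlock, ← hN]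
    congr 1
    rw [Matrix.sub_mul, Matrix.one_mul, Matrix.mul_sub]
    simp only [← Matrix.mul_assoc, hNB, Matrix.transpose_mul, Matrix.zero_mul, sub_zero]
  have hc : c ≠ 0 := by
    rintro rfl
    simp at hy
  set T := Matrix.toEuclideanLin (gammaBlock B C) with hT
  have hev : Module.End.HasEigenvalue (LinearMap.adjoint T ∘ₗ T) (ω ^ 2) := by
    refine Module.End.hasEigenvalue_of_hasEigenvector (x := WithLp.toLp 2 c) ⟨?_, ?_⟩
    · rw [Module.End.mem_eigenspace_iff, hT, ← Matrix.toEuclideanLin_conjTranspose_eq_adjoint,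
        Matrix.conjTranspose_eq_transpose_of_trivial]
      exact congrArg (WithLp.toLp 2) hΓ
    · simpa using hc
  obtain ⟨i, hi⟩ := T.isSymmetric_adjoint_comp_self.exists_eigenvalues_eq
    (finrank_euclideanSpace_fin (𝕜 := ℝ)) hev
  refine ⟨i, i.2, ?_⟩
  rw [T.singularValues_fin (finrank_euclideanSpace_fin (𝕜 := ℝ)) i]
  have : T.isSymmetric_adjoint_comp_self.eigenvalues (finrank_euclideanSpace_fin (𝕜 := ℝ)) i
    = ω ^ 2 := by exact_mod_cast hi
  rw [this, Real.sqrt_sq_eq_abs]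

end LinearAlgebra

/-! ### Persistence of roots -/

/-- A Rouché-type argument: on a small circle free of zeros of `G · 0` the values stay away from
zero for small `ε`, while the value at the center is tiny, so a quantitative open mapping theorem
produces a zero inside. -/
theorem exists_root_nearby {G : ℂ → ℝ → ℂ} (hGc : Continuous fun u : ℂ × ℝ => G u.1 u.2)
    (hGd : ∀ ε, Differentiable ℂ fun ν => G ν ε) {ν₀ : ℂ} (h0 : G ν₀ 0 = 0)
    (hne : ∃ ν, G ν 0 ≠ 0) {r : ℝ} (hr : 0 < r) :
    ∀ᶠ ε in 𝓝 (0 : ℝ), ∃ ν ∈ Metric.closedBall ν₀ r, G ν ε = 0 := by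
  have hconst : ∀ ε : ℝ, ∀ c : ℂ, (∀ᶠ z in 𝓝 ν₀, G z ε = c) → ∀ z, G z ε = c := by
    intro ε c h z
    have h1 : AnalyticOnNhd ℂ (fun ν => G ν ε) Set.univ := fun z _ => (hGd ε).analyticAt z
    exact congrFun (h1.eq_of_eventuallyEq (g := fun _ => c) (fun _ _ => analyticAt_const) h) z
  have hiso : ∀ᶠ z in 𝓝[≠] ν₀, G z 0 ≠ 0 := by
    refine ((hGd 0).analyticAt ν₀).eventually_eq_zero_or_eventually_ne_zero.resolve_left fun h => ?_
    obtain ⟨ν, hν⟩ := hne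
    exact hν (hconst 0 0 h ν)
  obtain ⟨r₁, hr₁, hball⟩ := Metric.eventually_nhds_iff_ball.1 (eventually_nhdsWithin_iff.1 hiso)
  obtain ⟨ρ, hρ, hρr⟩ : ∃ ρ > 0, ρ < min r r₁ := exists_between (lt_min hr hr₁)
  have hsphere : ∀ z ∈ Metric.sphere ν₀ ρ, G z 0 ≠ 0 := fun z hz => by
    refine hball z ?_ ?_
    · rw [Metric.mem_ball, Metric.mem_sphere.1 hz]
      exact hρr.trans_le (min_le_right _ _)
    · rintro rfl
      simp at hz
      exact hρ.ne hz
  have hcomp := isCompact_sphere ν₀ ρ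
  have hcont0 : Continuous fun z => ‖G z 0‖ :=
    (hGc.comp (continuous_id.prodMk continuous_const)).norm
  obtain ⟨m, hm, hmG⟩ : ∃ m > 0, ∀ z ∈ Metric.sphere ν₀ ρ, m ≤ ‖G z 0‖ := by
    obtain ⟨w, hw, hmin⟩ := hcomp.exists_isMinOn
      (NormedSpace.sphere_nonempty.2 hρ.le) hcont0.continuousOn
    exact ⟨_, norm_pos_iff.2 (hsphere w hw), fun z hz => hmin hz⟩
  have hev1 : ∀ᶠ ε in 𝓝 (0 : ℝ), ∀ z ∈ Metric.sphere ν₀ ρ, m / 2 < ‖G z ε‖ := by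
    refine hcomp.eventually_forall_of_forall_eventually fun z hz => ?_
    have : Continuous fun u : ℝ × ℂ => ‖G u.2 u.1‖ :=
      (hGc.comp (continuous_snd.prodMk continuous_fst)).norm
    exact this.continuousAt.eventually (lt_mem_nhds (by have := hmG z hz; simp only; linarith))
  have hev2 : ∀ᶠ ε in 𝓝 (0 : ℝ), ‖G ν₀ ε‖ < m / 8 := by
    have : Continuous fun ε => ‖G ν₀ ε‖ := (hGc.comp (continuous_const.prodMk continuous_id)).norm
    exact this.continuousAt.eventually (gt_mem_nhds (by simp only [h0, norm_zero]; positivity))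
  filter_upwards [hev1, hev2] with ε h1 h2
  have hdiff : ∀ z ∈ Metric.sphere ν₀ ρ, m / 4 ≤ ‖G z ε - G ν₀ ε‖ := fun z hz => by
    have := norm_sub_norm_le (G z ε) (G ν₀ ε)
    have := h1 z hz
    linarith
  -- The image contains the ball about `G ν₀ ε` of half the radius `m / 4`; this is why `m / 8` was
  -- required at the center.
  have hsub := ((hGd ε).diffContOnCl (s := Metric.ball ν₀ ρ)).ball_subset_image_closedBall hρ
    hdiff (by
      intro h
      simp only [not_not] at h
      obtain ⟨z, hz⟩ := (NormedSpace.sphere_nonempty (x := ν₀)).2 hρ.le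
      have h3 := hdiff z hz
      rw [hconst ε _ h z, sub_self, norm_zero] at h3
      linarith)
  obtain ⟨ν, hν, hν0⟩ := hsub (show (0 : ℂ) ∈ _ by
    rw [mem_ball_iff_norm, zero_sub, norm_neg]; linarith)
  exact ⟨ν, Metric.closedBall_subset_closedBall (hρr.trans_le (min_le_left _ _)).le hν, hν0⟩

/-! ### Complexification -/

section Complexification

open scoped Matrix

/-- The complexification of a real matrix. -/
abbrev cx {m n : Type*} (M : Matrix m n ℝ) : Matrix m n ℂ := M.map (algebraMap ℝ ℂ)

theorem re_cx_mulVec {m n : Type*} [Fintype n] (M : Matrix m n ℝ) (v : n → ℂ) :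
    (fun i => ((cx M *ᵥ v) i).re) = M *ᵥ fun i => (v i).re := by
  funext i
  simp [Matrix.mulVec, dotProduct]

theorem im_cx_mulVec {m n : Type*} [Fintype n] (M : Matrix m n ℝ) (v : n → ℂ) :
    (fun i => ((cx M *ᵥ v) i).im) = M *ᵥ fun i => (v i).im := by
  funext i
  simp [Matrix.mulVec, dotProduct]

theorem cx_mulVec_ofReal {m n : Type*} [Fintype n] (M : Matrix m n ℝ) (v : n → ℝ) :
    cx M *ᵥ (fun i => (v i : ℂ)) = fun i => ((M *ᵥ v) i : ℂ) := by
  funext i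
  simp [Matrix.mulVec, dotProduct]

variable {A : Matrix (Fin d₁) (Fin d₁) ℝ} {B : Matrix (Fin d₂) (Fin d₂) ℝ}
  {C : Matrix (Fin d₁) (Fin d₂) ℝ}

theorem mem_spectrum_cx_saddleMatrix_iff {ε : ℝ} {l : ℂ} :
    l ∈ spectrum ℂ (cx (saddleMatrix A B C ε)) ↔ ∃ x y, (x ≠ 0 ∨ y ≠ 0) ∧
      (ε : ℂ) • (cx A *ᵥ x + cx C *ᵥ y) = l • x ∧ -(cx Cᵀ *ᵥ x) - cx B *ᵥ y = l • y := by
  have hmul (x : Fin d₁ → ℂ) (y : Fin d₂ → ℂ) : cx (saddleMatrix A B C ε) *ᵥ Sum.elim x y =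
      Sum.elim ((ε : ℂ) • (cx A *ᵥ x + cx C *ᵥ y)) (-(cx Cᵀ *ᵥ x) - cx B *ᵥ y) := by
    have h1 : cx (ε • A) = (ε : ℂ) • cx A := by ext; simp
    have h2 : cx (ε • C) = (ε : ℂ) • cx C := by ext; simp
    have h3 : cx (-Cᵀ) = -cx Cᵀ := by ext; simp
    have h4 : cx (-B) = -cx B := by ext; simp
    have h5 : cx (saddleMatrix A B C ε) =
        Matrix.fromBlocks (cx (ε • A)) (cx (ε • C)) (cx (-Cᵀ)) (cx (-B)) :=
      Matrix.fromBlocks_map ..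
    rw [h5, h1, h2, h3, h4, Matrix.fromBlocks_mulVec]
    simp [Matrix.smul_mulVec, Matrix.neg_mulVec, sub_eq_add_neg]
  rw [mem_spectrum_iff_exists_mulVec]
  constructor
  · rintro ⟨v, hv, h⟩
    refine ⟨v ∘ Sum.inl, v ∘ Sum.inr, ?_, ?_⟩
    · by_contra! h0
      refine hv ?_
      rw [← Sum.elim_comp_inl_inr v, h0.1, h0.2]
      ext (i | i) <;> rfl
    · rw [← Sum.elim_comp_inl_inr v, hmul] at h
      exact ⟨funext fun i => congrFun h (Sum.inl i), funext fun i => congrFun h (Sum.inr i)⟩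
  · rintro ⟨x, y, h0, h1, h2⟩
    refine ⟨Sum.elim x y, ?_, ?_⟩
    · intro h
      rcases h0 with h0 | h0
      · exact h0 (funext fun i => congrFun h (Sum.inl i))
      · exact h0 (funext fun i => congrFun h (Sum.inr i))
    · rw [hmul, h1, h2]
      ext (i | i) <;> rfl

theorem saddleMatrix_kernel_cx (hJ : (saddleMatrix A B C 1).det ≠ 0) {x : Fin d₁ → ℂ}
    {y : Fin d₂ → ℂ} (h1 : cx A *ᵥ x + cx C *ᵥ y = 0) (h2 : cx Cᵀ *ᵥ x + cx B *ᵥ y = 0) :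
    x = 0 ∧ y = 0 := by
  have e1 := saddleMatrix_kernel hJ (x := fun i => (x i).re) (y := fun i => (y i).re)
    (by
      rw [← re_cx_mulVec, ← re_cx_mulVec]
      funext i
      simpa using congrArg Complex.re (congrFun h1 i))
    (by
      rw [← re_cx_mulVec, ← re_cx_mulVec]
      funext i
      simpa using congrArg Complex.re (congrFun h2 i))
  have e2 := saddleMatrix_kernel hJ (x := fun i => (x i).im) (y := fun i => (y i).im)
    (by
      rw [← im_cx_mulVec, ← im_cx_mulVec]
      funext i
      simpa using congrArg Complex.im (congrFun h1 i))
    (by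
      rw [← im_cx_mulVec, ← im_cx_mulVec]
      funext i
      simpa using congrArg Complex.im (congrFun h2 i))
  exact ⟨funext fun i => Complex.ext (congrFun e1.1 i) (congrFun e2.1 i),
    funext fun i => Complex.ext (congrFun e1.2 i) (congrFun e2.2 i)⟩

/-- All eigenvalues of `[[ε A, ε C], [-Cᵀ, -B]]` satisfy `Re λ + s |λ|² > 0` for small `ε > 0`. -/
def EventuallyOutside (A : Matrix (Fin d₁) (Fin d₁) ℝ) (B : Matrix (Fin d₂) (Fin d₂) ℝ)
    (C : Matrix (Fin d₁) (Fin d₂) ℝ) (s : ℝ) : Prop :=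
  ∀ᶠ ε in 𝓝[>] (0 : ℝ), ∀ l ∈ spectrum ℂ (cx (saddleMatrix A B C ε)),
    0 < l.re + s * Complex.normSq l

/-! ### Necessity of the definiteness conditions -/

/-- At `ε = 0` every eigenvalue `μ` of `-B` is an eigenvalue of the matrix. If `μ < 0`, then `s|μ| ≤
sL < 1` puts it in the open disc `Re l + s|l|² < 0`, where nearby eigenvalues for small `ε > 0`
remain. -/
theorem EventuallyOutside.neg_posSemidef (hB : B.IsSymm) {s L : ℝ} (hs : 0 < s) (hsL : s * L < 1)
    (hJL : ‖Matrix.toEuclideanCLM (n := Fin d₁ ⊕ Fin d₂) (𝕜 := ℝ) (saddleMatrix A B C 1)‖ ≤ L)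
    (h : EventuallyOutside A B C s) : (-B).PosSemidef := by
  have hH : (-B).IsHermitian := by
    rw [Matrix.IsHermitian, Matrix.conjTranspose_eq_transpose_of_trivial, Matrix.transpose_neg,
      hB.eq]
  by_contra hP
  rw [hH.posSemidef_iff_eigenvalues_nonneg, Pi.le_def] at hP
  push Not at hP
  obtain ⟨i, hi⟩ := hP
  set μ : ℝ := hH.eigenvalues i with hμ
  have hμ0 : μ < 0 := hi
  set v : Fin d₂ → ℝ := (hH.eigenvectorBasis i).ofLp with hv
  have hBv : (-B) *ᵥ v = μ • v := hH.mulVec_eigenvectorBasis i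
  have hvn : ‖WithLp.toLp 2 v‖ = 1 := hH.eigenvectorBasis.orthonormal.1 i
  -- Applied to the unit vector `(0, v)`, the Jacobian has second component `-Bv = μv`.
  have hμL : |μ| ≤ L := by
    have h1 : ‖WithLp.toLp 2 (Sum.elim (0 : Fin d₁ → ℝ) v)‖ = 1 := by
      rw [← hvn, EuclideanSpace.norm_eq, EuclideanSpace.norm_eq, Fintype.sum_sum_type]
      simp
    have h2 := ContinuousLinearMap.le_of_opNorm_le _ hJL (WithLp.toLp 2 (Sum.elim 0 v))
    rw [h1, mul_one] at h2
    refine le_trans ?_ h2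
    have h3 : |μ| = ‖WithLp.toLp 2 (μ • v)‖ := by
      rw [WithLp.toLp_smul, norm_smul, hvn, mul_one, Real.norm_eq_abs]
    rw [h3, EuclideanSpace.norm_eq, EuclideanSpace.norm_eq, Fintype.sum_sum_type]
    refine Real.sqrt_le_sqrt ?_
    rw [← hBv]
    simp only [Matrix.ofLp_toEuclideanCLM, saddleMatrix, Matrix.fromBlocks_mulVec]
    simp only [Sum.elim_inl, Sum.elim_inr, Sum.elim_comp_inr, Sum.elim_comp_inl,
      Matrix.mulVec_zero, zero_add]
    exact le_add_of_nonneg_left (Finset.sum_nonneg fun _ _ => sq_nonneg _)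
  have hneg : μ + s * μ ^ 2 < 0 := by
    have : s * |μ| < 1 := (mul_le_mul_of_nonneg_left hμL hs.le).trans_lt hsL
    rw [abs_of_neg hμ0] at this
    nlinarith
  have hcont : Continuous fun l : ℂ => l.re + s * Complex.normSq l :=
    Complex.continuous_re.add (continuous_const.mul Complex.continuous_normSq)
  have hnear : ∀ᶠ l in 𝓝 (μ : ℂ), l.re + s * Complex.normSq l < 0 :=
    hcont.continuousAt.eventually (gt_mem_nhds (by
      simp only [Complex.ofReal_re, Complex.normSq_ofReal]; nlinarith))
  obtain ⟨r, hr, hball⟩ := Metric.eventually_nhds_iff_ball.1 hnear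
  let G : ℂ → ℝ → ℂ := fun ν ε =>
    (algebraMap ℂ (Matrix _ _ ℂ) ν - cx (saddleMatrix A B C ε)).det
  have hG : ∀ ν ε, G ν ε = 0 ↔ ν ∈ spectrum ℂ (cx (saddleMatrix A B C ε)) := fun ν ε => by
    rw [spectrum.mem_iff, Matrix.isUnit_iff_isUnit_det, isUnit_iff_ne_zero, not_not]
  have hGc : Continuous fun u : ℂ × ℝ => G u.1 u.2 := by
    refine Continuous.matrix_det (Continuous.sub ?_ ?_)
    · simp only [Algebra.algebraMap_eq_smul_one]
      fun_prop
    · refine continuous_matrix fun i j => ?_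
      rcases i with i | i <;> rcases j with j | j <;> simp [saddleMatrix] <;> fun_prop
  have hGchar : ∀ ν ε, G ν ε = (cx (saddleMatrix A B C ε)).charpoly.eval ν := fun ν ε => by
    rw [Matrix.eval_charpoly]; rfl
  have hroot := exists_root_nearby (G := G) (ν₀ := μ) (r := r / 2) hGc
    (fun ε => by
      have : (fun ν => G ν ε) = fun ν => (cx (saddleMatrix A B C ε)).charpoly.eval ν :=
        funext fun ν => hGchar ν ε
      rw [this]
      exact Polynomial.differentiable _)
    (by
      rw [hG, mem_spectrum_cx_saddleMatrix_iff]
      refine ⟨0, fun i => (v i : ℂ), Or.inr ?_, by simp, ?_⟩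
      · intro h0
        have : v = 0 := funext fun i => by simpa using congrFun h0 i
        rw [this] at hvn
        simp at hvn
      · rw [cx_mulVec_ofReal]
        funext i
        have := congrFun hBv i
        simp only [Matrix.neg_mulVec, Pi.neg_apply, Pi.smul_apply, smul_eq_mul] at this
        simp [← Complex.ofReal_neg, this])
    (by
      simp only [hGchar]
      by_contra! h0
      exact (Matrix.charpoly_monic _).ne_zero (Polynomial.funext (by simpa using h0)))
    (by positivity)
  obtain ⟨ε, hε1, ν, hν, hν0⟩ := (h.and (hroot.filter_mono nhdsWithin_le_nhds)).exists
  have h1 := hε1 ν ((hG _ _).1 hν0)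
  have h2 := hball ν (Metric.closedBall_subset_ball (by linarith) hν)
  linarith

/-- A negative eigenvalue `ν₀` of the restricted Schur complement yields eigenvalues `εν` with `ν`
near `ν₀`: the real part is negative of order `ε`, and `s|εν|²` of order `ε²` cannot compensate. -/
theorem EventuallyOutside.restrictedSchur_posSemidef (hA : A.IsSymm) (hB : B.IsSymm)
    (hJ : (saddleMatrix A B C 1).det ≠ 0) {s : ℝ} (hs : 0 < s) (h : EventuallyOutside A B C s) :
    (restrictedSchur A B C).PosSemidef := by
  by_contra hS
  obtain ⟨ν₀, hν₀, x₀, w₀, hx₀, e1, e2⟩ := exists_neg_root_of_not_posSemidef hA hB hS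
  -- The eigenvalue equation for `εν` with its first row divided by `ε`, which remains meaningful at
  -- `ε = 0`.
  let M : ℂ → ℝ → Matrix (Fin d₁ ⊕ Fin d₂) (Fin d₁ ⊕ Fin d₂) ℂ := fun ν ε =>
    Matrix.fromBlocks (cx A - ν • (1 : Matrix (Fin d₁) (Fin d₁) ℂ)) (cx C) (-cx Cᵀ)
      (-cx B - ((ε : ℂ) * ν) • (1 : Matrix (Fin d₂) (Fin d₂) ℂ))
  have hM : ∀ ν ε, (M ν ε).det = 0 ↔ ∃ x y, (x ≠ 0 ∨ y ≠ 0) ∧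
      cx A *ᵥ x + cx C *ᵥ y = ν • x ∧ -(cx Cᵀ *ᵥ x) - cx B *ᵥ y = (ε * ν) • y := by
    intro ν ε
    have hmul (x : Fin d₁ → ℂ) (y : Fin d₂ → ℂ) : M ν ε *ᵥ Sum.elim x y =
        Sum.elim (cx A *ᵥ x + cx C *ᵥ y - ν • x)
          (-(cx Cᵀ *ᵥ x) - cx B *ᵥ y - (ε * ν) • y) := by
      simp only [M, Matrix.fromBlocks_mulVec, Sum.elim_comp_inl, Sum.elim_comp_inr,
        Matrix.sub_mulVec, Matrix.neg_mulVec, Matrix.smul_mulVec, Matrix.one_mulVec]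
      congr 1
      · abel
      · abel
    rw [← Matrix.exists_mulVec_eq_zero_iff]
    constructor
    · rintro ⟨v, hv, h⟩
      refine ⟨v ∘ Sum.inl, v ∘ Sum.inr, ?_, ?_⟩
      · by_contra! h0
        refine hv ?_
        rw [← Sum.elim_comp_inl_inr v, h0.1, h0.2]
        ext (i | i) <;> rfl
      · rw [← Sum.elim_comp_inl_inr v, hmul] at h
        exact ⟨sub_eq_zero.1 (funext fun i => congrFun h (Sum.inl i)),
          sub_eq_zero.1 (funext fun i => congrFun h (Sum.inr i))⟩
    · rintro ⟨x, y, h0, h1, h2⟩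
      refine ⟨Sum.elim x y, ?_, ?_⟩
      · intro h
        rcases h0 with h0 | h0
        · exact h0 (funext fun i => congrFun h (Sum.inl i))
        · exact h0 (funext fun i => congrFun h (Sum.inr i))
      · rw [hmul, h1, h2, sub_self, sub_self]
        ext (i | i) <;> rfl
  have hroot := exists_root_nearby (G := fun ν ε => (M ν ε).det) (ν₀ := ν₀) (r := -ν₀ / 2)
    (by
      refine Continuous.matrix_det (continuous_matrix fun i j => ?_)
      rcases i with i | i <;> rcases j with j | j <;> (simp [M]; fun_prop))
    (fun ε => by
      have : ∀ i j, Differentiable ℂ fun ν => M ν ε i j := by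
        intro i j
        rcases i with i | i <;> rcases j with j | j <;> (simp [M]; try fun_prop)
      simp only [Matrix.det_apply]
      fun_prop)
    (by
      rw [hM]
      refine ⟨fun i => (x₀ i : ℂ), fun i => (w₀ i : ℂ), Or.inl ?_, ?_, ?_⟩
      · intro h0
        exact hx₀ (funext fun i => by simpa using congrFun h0 i)
      · rw [cx_mulVec_ofReal, cx_mulVec_ofReal]
        funext i
        have := congrFun e1 i
        simp only [Pi.add_apply, Pi.smul_apply, smul_eq_mul] at this ⊢
        exact_mod_cast this
      · rw [cx_mulVec_ofReal, cx_mulVec_ofReal]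
        funext i
        have := congrFun e2 i
        simp only [Pi.add_apply, Pi.zero_apply] at this
        simp only [Complex.ofReal_zero, zero_mul, zero_smul, Pi.sub_apply, Pi.neg_apply,
          Pi.zero_apply]
        rw [neg_sub_left, ← Complex.ofReal_add, add_comm, this]
        simp)
    ⟨0, by
      rw [Ne, hM]
      rintro ⟨x, y, h0, h1, h2⟩
      simp only [zero_smul, mul_zero] at h1 h2
      rw [neg_sub_left, neg_eq_zero, add_comm] at h2
      have := saddleMatrix_kernel_cx hJ h1 h2
      tauto⟩
    (by linarith)
  -- In the disc of radius `-ν₀ / 2` about `ν₀` one has `Re ν ≤ ν₀ / 2` and `|ν| ≤ (3/2)|ν₀|`,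
  -- whence the constant `9 / 4`.
  have hsmall : ∀ᶠ ε in 𝓝[>] (0 : ℝ), ν₀ / 2 + s * ε * (9 / 4 * ν₀ ^ 2) < 0 := by
    have : Continuous fun ε : ℝ => ν₀ / 2 + s * ε * (9 / 4 * ν₀ ^ 2) := by fun_prop
    exact (this.continuousAt.eventually (gt_mem_nhds (by simp; linarith))).filter_mono
      nhdsWithin_le_nhds
  obtain ⟨ε, ⟨⟨hε1, ν, hν, hν0⟩, hε2⟩, hε0⟩ := (((h.and (hroot.filter_mono
    nhdsWithin_le_nhds)).and hsmall).and self_mem_nhdsWithin).exists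
  have hε : 0 < ε := hε0
  obtain ⟨x, y, h0, h1, h2⟩ := (hM _ _).1 hν0
  have h3 := hε1 (ε * ν) (mem_spectrum_cx_saddleMatrix_iff.2
    ⟨x, y, h0, by rw [h1, smul_smul], h2⟩)
  rw [mem_closedBall_iff_norm] at hν
  have h4 : ν.re ≤ ν₀ / 2 := by
    have := (le_abs_self _).trans ((Complex.abs_re_le_norm (ν - ν₀)).trans hν)
    simp at this
    linarith
  have h5 : ‖ν‖ ≤ -(3 / 2) * ν₀ := by
    have h6 := norm_le_norm_add_norm_sub' ν (ν₀ : ℂ)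
    rw [Complex.norm_real, Real.norm_eq_abs, abs_of_neg hν₀] at h6
    linarith
  have h6 : Complex.normSq ν ≤ 9 / 4 * ν₀ ^ 2 := by
    rw [Complex.normSq_eq_norm_sq]
    nlinarith [norm_nonneg ν]
  have h7 : ((ε * ν : ℂ)).re + s * Complex.normSq (ε * ν) =
      ε * (ν.re + s * ε * Complex.normSq ν) := by
    rw [Complex.normSq_mul, Complex.normSq_ofReal]
    simp
    ring
  rw [h7] at h3
  have h8 := (mul_pos_iff_of_pos_left hε).1 h3
  have h9 : s * ε * Complex.normSq ν ≤ s * ε * (9 / 4 * ν₀ ^ 2) := by gcongr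
  linarith

end Complexification

/-! ### Leading terms of Puiseux series -/

/-- Convergence at `r` bounds `|b k| r ^ k`, so for `|t| < r / 2` the series is dominated by a
geometric one. -/
theorem tendsto_tsum_mul_pow_nhds_zero {b : ℕ → ℝ} {r : ℝ} (hr : 0 < r)
    (hb : Summable fun k => b k * r ^ k) :
    Tendsto (fun t => ∑' k, b k * t ^ k) (𝓝 0) (𝓝 (b 0)) := by
  obtain ⟨M, hM⟩ := hb.tendsto_atTop_zero.norm.bddAbove_range
  have hM' : ∀ k, |b k| * r ^ k ≤ M := fun k => by
    have := hM (Set.mem_range_self k)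
    rwa [Real.norm_eq_abs, abs_mul, abs_of_pos (pow_pos hr k)] at this
  have hlim : ∑' k, (if k = 0 then b 0 else 0) = b 0 := by simp
  rw [← hlim]
  refine tendsto_tsum_of_dominated_convergence (bound := fun k => M * (1 / 2) ^ k)
    (summable_geometric_two.mul_left M) (fun k => ?_) ?_
  · have : Continuous fun t : ℝ => b k * t ^ k := by fun_prop
    have h := this.tendsto 0
    rcases eq_or_ne k 0 with rfl | hk
    · simp
    · simpa [hk] using h
  · have hev : ∀ᶠ t : ℝ in 𝓝 0, |t| < r / 2 :=
      continuous_abs.continuousAt.eventually (gt_mem_nhds (by rw [abs_zero]; positivity))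
    filter_upwards [hev] with t ht k
    rw [Real.norm_eq_abs, abs_mul, abs_pow]
    calc |b k| * |t| ^ k ≤ |b k| * (r / 2) ^ k := by gcongr
      _ = |b k| * r ^ k * (1 / 2) ^ k := by rw [div_eq_mul_one_div, mul_pow, mul_assoc]
      _ ≤ M * (1 / 2) ^ k := by gcongr; exact hM' k

theorem rpow_natCast_div {ε : ℝ} (hε : 0 < ε) (k p : ℕ) :
    ε ^ ((k : ℝ) / (p : ℝ)) = (ε ^ (1 / (p : ℝ))) ^ k := by
  rw [← Real.rpow_natCast, ← Real.rpow_mul hε.le]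
  congr 1
  ring

theorem tendsto_rpow_one_div {p : ℕ} (hp : 0 < p) :
    Tendsto (fun ε : ℝ => ε ^ (1 / (p : ℝ))) (𝓝[>] 0) (𝓝[>] 0) := by
  have h : 0 < 1 / (p : ℝ) := by positivity
  refine tendsto_nhdsWithin_iff.2 ⟨?_, ?_⟩
  · have := (Real.continuousAt_rpow_const 0 (1 / (p : ℝ)) (Or.inr h.le)).tendsto
    rw [Real.zero_rpow h.ne'] at this
    exact this.mono_left nhdsWithin_le_nhds
  · filter_upwards [self_mem_nhdsWithin] with ε hε
    exact Real.rpow_pos_of_pos hε _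

/-- The real part of a Puiseux series is asymptotic to its leading term. -/
theorem HasPuiseux.re_eq_leading_mul {lam : ℝ → ℂ} {p : ℕ} {α : ℕ → ℂ} {ϱ ξ : ℝ}
    (h : HasPuiseux lam p α) (hl : IsLeadingReal p α ϱ ξ) :
    ∃ ρ : ℝ → ℝ, Tendsto ρ (𝓝[>] 0) (𝓝 1) ∧
      ∀ᶠ ε in 𝓝[>] (0 : ℝ), (lam ε).re = ξ * ε ^ ϱ * ρ ε := by
  have hre : ∀ᶠ ε in 𝓝[>] (0 : ℝ),
      HasSum (fun k : ℕ => (α k).re * (ε ^ (1 / (p : ℝ))) ^ k) (lam ε).re := by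
    filter_upwards [h.hasSum, self_mem_nhdsWithin] with ε h1 hε
    have := Complex.hasSum_re h1
    simpa only [Complex.re_mul_ofReal, rpow_natCast_div hε] using this
  rcases hl with ⟨k₀, hk₀, hlt, rfl, rfl⟩ | ⟨h0, rfl, rfl⟩
  -- In the variable `ε ^ (1 / p)` this is an ordinary power series; its first `k₀` real parts
  -- vanish and can be factored out.
  · have hshift : ∀ᶠ ε in 𝓝[>] (0 : ℝ),
        HasSum (fun k : ℕ => (α (k + k₀)).re * (ε ^ (1 / (p : ℝ))) ^ k)
          ((lam ε).re / ε ^ ((k₀ : ℝ) / p)) := by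
      filter_upwards [hre, self_mem_nhdsWithin] with ε h1 hε
      have hne : (ε ^ (1 / (p : ℝ))) ^ k₀ ≠ 0 := pow_ne_zero _ (Real.rpow_pos_of_pos hε _).ne'
      rw [← hasSum_nat_add_iff' k₀, Finset.sum_eq_zero, sub_zero] at h1
      · rw [rpow_natCast_div hε]
        have h2 : (fun k => (α (k + k₀)).re * (ε ^ (1 / (p : ℝ))) ^ k) = fun k =>
            (α (k + k₀)).re * (ε ^ (1 / (p : ℝ))) ^ (k + k₀) / (ε ^ (1 / (p : ℝ))) ^ k₀ := by
          funext k
          rw [pow_add, mul_div_assoc, mul_div_cancel_right₀ _ hne]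
        rw [h2]
        exact h1.div_const _
      · intro i hi
        rw [hlt i (Finset.mem_range.1 hi), zero_mul]
    obtain ⟨ε₀, hε₀, hε₀'⟩ := (hshift.and self_mem_nhdsWithin).exists
    have hT := (tendsto_tsum_mul_pow_nhds_zero (Real.rpow_pos_of_pos hε₀' _)
      hε₀.summable).comp ((tendsto_rpow_one_div h.pos).mono_right nhdsWithin_le_nhds)
    refine ⟨fun ε => (lam ε).re / ε ^ ((k₀ : ℝ) / p) / (α k₀).re, ?_, ?_⟩
    · have h2 := (hT.div_const (α k₀).re)
      rw [zero_add, div_self hk₀] at h2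
      refine h2.congr' ?_
      filter_upwards [hshift] with ε hε
      simp only [Function.comp, hε.tsum_eq]
    · filter_upwards [self_mem_nhdsWithin] with ε hε
      have : ε ^ ((k₀ : ℝ) / p) ≠ 0 := (Real.rpow_pos_of_pos hε _).ne'
      field_simp
  · refine ⟨fun _ => 1, tendsto_const_nhds, ?_⟩
    filter_upwards [hre] with ε hε
    simp only [h0, zero_mul] at hε
    simp [hε.unique hasSum_zero]

theorem tendsto_div_sqrt_of_isLittleO {lam : ℝ → ℂ} {σ : ℝ} {c : ℂ}
    (h : (fun ε => lam ε - c * ((σ * √ε : ℝ) : ℂ)) =o[𝓝[>] 0] fun ε => √ε) :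
    Tendsto (fun ε => lam ε / ((√ε : ℝ) : ℂ)) (𝓝[>] 0) (𝓝 (c * σ)) := by
  have h' : (fun ε => lam ε - c * ((σ * √ε : ℝ) : ℂ)) =o[𝓝[>] 0] fun ε => ((√ε : ℝ) : ℂ) := by
    refine Asymptotics.IsLittleO.of_norm_right ?_
    simpa using h.norm_right
  have h1 := h'.tendsto_div_nhds_zero
  have h2 := h1.add_const (c * σ)
  rw [zero_add] at h2
  refine h2.congr' ?_
  filter_upwards [self_mem_nhdsWithin] with ε hε
  have : ((√ε : ℝ) : ℂ) ≠ 0 := by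
    exact_mod_cast (Real.sqrt_pos.2 hε).ne'
  push_cast
  field_simp
  ring

/-- Divided by `σ²ε`, the stability inequality reads `(ξ ε^(ϱ-1)/σ²) ρ + s q > 0` with `ρ → 1` and
`q → 1`. If `ι < -s`, a real `r` strictly between them would give `r + s ≥ 0` in the limit; this
also covers `ι = -∞`. -/
theorem IsHemicurvature.neg_le {f : Z d₁ d₂ → ℝ} {z : Z d₁ d₂} {ι : EReal}
    (h : IsHemicurvature f z ι)
    (hσ : ∀ σ ∈ gammaSingularValues (hessYY f z) (hessXY f z), 0 < σ) {s : ℝ}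
    (hs : ∀ᶠ ε in 𝓝[>] (0 : ℝ), ∀ l ∈ complexSpectrum (timescaledJacobian f (1 / ε) z),
        0 < l.re + s * Complex.normSq l) : -ι ≤ (s : EReal) := by
  obtain ⟨lam, σ, p, α, ϱ, ξ, hlam, hσΓ, hasym, hpuis, hlead, hlim⟩ := h
  have hσ0 := hσ σ hσΓ
  obtain ⟨ρ, hρ, hρlam⟩ := hpuis.re_eq_leading_mul hlead
  have hq : Tendsto (fun ε => Complex.normSq (lam ε) / (σ ^ 2 * ε)) (𝓝[>] 0) (𝓝 1) := by
    obtain ⟨c, hc, hc'⟩ : ∃ c : ℂ, Complex.normSq c = 1 ∧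
        Tendsto (fun ε => lam ε / ((√ε : ℝ) : ℂ)) (𝓝[>] 0) (𝓝 (c * σ)) := by
      rcases hasym with h | h
      · exact ⟨Complex.I, by simp, tendsto_div_sqrt_of_isLittleO h⟩
      · exact ⟨-Complex.I, by simp, tendsto_div_sqrt_of_isLittleO (by simpa using h)⟩
    have h1 := ((Complex.continuous_normSq.tendsto _).comp hc').div_const (σ ^ 2)
    rw [Complex.normSq_mul, hc, Complex.normSq_ofReal, one_mul, ← sq,
      div_self (by positivity)] at h1
    refine h1.congr' ?_
    filter_upwards [self_mem_nhdsWithin] with ε hε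
    simp only [Function.comp, Complex.normSq_div, Complex.normSq_ofReal,
      Real.mul_self_sqrt (le_of_lt hε)]
    rw [div_div, mul_comm]
  rw [EReal.neg_le]
  by_contra! hlt
  obtain ⟨r, hr1, hr2⟩ := EReal.lt_iff_exists_real_btwn.1 hlt
  have hr2' : r < -s := by
    rw [← EReal.coe_neg] at hr2
    exact_mod_cast hr2
  have hR : ∀ᶠ ε in 𝓝[>] (0 : ℝ), ξ * ε ^ (ϱ - 1) / σ ^ 2 < r := by
    filter_upwards [hlim.eventually (gt_mem_nhds hr1)] with ε hε
    exact_mod_cast hε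
  have hev : ∀ᶠ ε in 𝓝[>] (0 : ℝ),
      0 ≤ r * ρ ε + s * (Complex.normSq (lam ε) / (σ ^ 2 * ε)) := by
    filter_upwards [hR, hs, hlam, hρlam, hρ.eventually (lt_mem_nhds zero_lt_one),
      self_mem_nhdsWithin] with ε h1 h2 h3 h4 h5 h6
    have hε : 0 < ε := h6
    have h7 := div_pos (h2 _ h3) (show 0 < σ ^ 2 * ε by positivity)
    have h8 : (lam ε).re / (σ ^ 2 * ε) = ξ * ε ^ (ϱ - 1) / σ ^ 2 * ρ ε := by
      rw [h4, Real.rpow_sub_one hε.ne']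
      field_simp
    rw [add_div, h8, mul_div_assoc s] at h7
    nlinarith
  have h9 := ge_of_tendsto ((hρ.const_mul r).add (hq.const_mul s)) hev
  linarith

/-! ### Limits of eigenpairs -/

section Limits

open scoped Matrix ComplexConjugate

/-- Replaces repeated extraction of subsequences: along one ultrafilter all bounded quantities
converge at once. -/
theorem _root_.Ultrafilter.exists_tendsto_of_eventually_norm_le {α E : Type*}
    [NormedAddCommGroup E] [ProperSpace E] (U : Ultrafilter α) {f : α → E} {K : ℝ}
    (h : ∀ᶠ a in (U : Filter α), ‖f a‖ ≤ K) : ∃ l, Tendsto f U (𝓝 l) := by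
  have h1 : f ⁻¹' Metric.closedBall (0 : E) K ∈ U := by
    filter_upwards [h] with a ha
    simpa using ha
  obtain ⟨l, -, hl⟩ := (isCompact_closedBall (0 : E) K).ultrafilter_le_nhds' (U.map f)
    (Ultrafilter.mem_map.2 h1)
  exact ⟨l, hl⟩

theorem tendsto_mulVec {α m n : Type*} [Fintype n] {F : Filter α} (M : Matrix m n ℂ)
    {v : α → n → ℂ} {v₀ : n → ℂ} (h : Tendsto v F (𝓝 v₀)) :
    Tendsto (fun a => M *ᵥ v a) F (𝓝 (M *ᵥ v₀)) :=
  ((Continuous.matrix_mulVec continuous_const continuous_id).tendsto v₀).comp h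

theorem tendsto_star_dotProduct {α n : Type*} [Fintype n] {F : Filter α}
    {v w : α → n → ℂ} {v₀ w₀ : n → ℂ} (hv : Tendsto v F (𝓝 v₀)) (hw : Tendsto w F (𝓝 w₀)) :
    Tendsto (fun a => star (v a) ⬝ᵥ w a) F (𝓝 (star v₀ ⬝ᵥ w₀)) := by
  simp only [dotProduct, Pi.star_apply]
  exact tendsto_finsetSum _ fun i _ =>
    ((continuous_star.tendsto _).comp (tendsto_pi_nhds.1 hv i)).mul (tendsto_pi_nhds.1 hw i)

theorem star_dotProduct_cx_mulVec {m n : Type*} [Fintype m] [Fintype n] (M : Matrix m n ℝ)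
    (u : m → ℂ) (v : n → ℂ) :
    star u ⬝ᵥ (cx M *ᵥ v) = conj (star v ⬝ᵥ (cx Mᵀ *ᵥ u)) := by
  simp only [dotProduct, Matrix.mulVec, Finset.mul_sum, map_sum]
  rw [Finset.sum_comm]
  refine Finset.sum_congr rfl fun i _ => Finset.sum_congr rfl fun j _ => ?_
  simp
  ring

theorem re_star_dotProduct_cx_mulVec {n : Type*} [Fintype n] (M : Matrix n n ℝ) (v : n → ℂ) :
    (star v ⬝ᵥ (cx M *ᵥ v)).re =
      (fun i => (v i).re) ⬝ᵥ (M *ᵥ fun i => (v i).re) +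
        (fun i => (v i).im) ⬝ᵥ (M *ᵥ fun i => (v i).im) := by
  rw [← re_cx_mulVec, ← im_cx_mulVec]
  simp [dotProduct, Finset.sum_add_distrib]

theorem re_star_dotProduct_cx_nonneg {n : Type*} [Fintype n] {M : Matrix n n ℝ}
    (hM : M.PosSemidef) (v : n → ℂ) : 0 ≤ (star v ⬝ᵥ (cx M *ᵥ v)).re := by
  rw [re_star_dotProduct_cx_mulVec]
  exact add_nonneg (by simpa using hM.dotProduct_mulVec_nonneg fun i => (v i).re)
    (by simpa using hM.dotProduct_mulVec_nonneg fun i => (v i).im)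

theorem star_dotProduct_self_eq {n : Type*} [Fintype n] (v : n → ℂ) :
    star v ⬝ᵥ v = ((∑ i, ‖v i‖ ^ 2 : ℝ) : ℂ) := by
  simp [dotProduct, Complex.conj_mul']

variable {A : Matrix (Fin d₁) (Fin d₁) ℝ} {B : Matrix (Fin d₂) (Fin d₂) ℝ}
  {C : Matrix (Fin d₁) (Fin d₂) ℝ}

/-- A normalized eigenvector of `[[δ² A, δ C], [-δ Cᵀ, -B]]` for the eigenvalue `l`. -/
structure IsScaledEigenpair (A : Matrix (Fin d₁) (Fin d₁) ℝ) (B : Matrix (Fin d₂) (Fin d₂) ℝ)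
    (C : Matrix (Fin d₁) (Fin d₂) ℝ) (δ : ℝ) (l : ℂ) (x : Fin d₁ → ℂ) (y : Fin d₂ → ℂ) :
    Prop where
  eq_fst : (δ : ℂ) ^ 2 • (cx A *ᵥ x) + (δ : ℂ) • (cx C *ᵥ y) = l • x
  eq_snd : -((δ : ℂ) • (cx Cᵀ *ᵥ x)) - cx B *ᵥ y = l • y
  normalized : star x ⬝ᵥ x + star y ⬝ᵥ y = 1

/-- Replacing `x` by `δ⁻¹x` makes the off-diagonal part of the matrix skew-symmetric, so that it
drops out of real parts. -/
theorem exists_isScaledEigenpair {δ : ℝ} (hδ : 0 < δ) {l : ℂ}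
    (hl : l ∈ spectrum ℂ (cx (saddleMatrix A B C (δ ^ 2)))) :
    ∃ x y, IsScaledEigenpair A B C δ l x y := by
  obtain ⟨x, y, h0, h1, h2⟩ := mem_spectrum_cx_saddleMatrix_iff.1 hl
  have hδ' : (δ : ℂ) ≠ 0 := by exact_mod_cast hδ.ne'
  let E : ℝ := ∑ i, ‖((δ : ℂ)⁻¹ • x) i‖ ^ 2 + ∑ i, ‖y i‖ ^ 2
  have hE : 0 < E := by
    by_contra! hE
    have e1 : 0 ≤ ∑ i, ‖((δ : ℂ)⁻¹ • x) i‖ ^ 2 := Finset.sum_nonneg fun _ _ => sq_nonneg _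
    have e2 : 0 ≤ ∑ i, ‖y i‖ ^ 2 := Finset.sum_nonneg fun _ _ => sq_nonneg _
    have e3 : ∑ i, ‖((δ : ℂ)⁻¹ • x) i‖ ^ 2 = 0 := by linarith
    have e4 : ∑ i, ‖y i‖ ^ 2 = 0 := by linarith
    rw [Finset.sum_eq_zero_iff_of_nonneg fun _ _ => sq_nonneg _] at e3 e4
    rcases h0 with h0 | h0
    · exact h0 (funext fun i => by simpa [hδ.ne'] using e3 i (Finset.mem_univ i))
    · exact h0 (funext fun i => by simpa using e4 i (Finset.mem_univ i))
  have hc : (((√E)⁻¹ : ℝ) : ℂ) * ((√E)⁻¹ : ℝ) * E = 1 := by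
    have := Real.mul_self_sqrt hE.le
    have h3 := (Real.sqrt_pos.2 hE).ne'
    rw [← Complex.ofReal_mul, ← Complex.ofReal_mul]
    norm_cast
    field_simp
    rw [sq, this]
  set c : ℂ := (((√E)⁻¹ : ℝ) : ℂ) with hcdef
  have hcc : star c = c := by rw [hcdef]; exact Complex.conj_ofReal _
  refine ⟨c • (δ : ℂ)⁻¹ • x, c • y, ?_, ?_, ?_⟩
  · have h3 : (δ : ℂ) ^ 2 • (cx A *ᵥ x) + (δ : ℂ) ^ 2 • (cx C *ᵥ y) = l • x := by
      rw [← h1, smul_add]; push_cast; rfl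
    simp only [Matrix.mulVec_smul]
    calc _ = (c * (δ : ℂ)⁻¹) • ((δ : ℂ) ^ 2 • (cx A *ᵥ x) + (δ : ℂ) ^ 2 • (cx C *ᵥ y)) := by
          simp only [smul_add, smul_smul]
          congr 2 <;> field_simp
      _ = _ := by
          rw [h3]; simp only [smul_smul]; congr 1; ring
  · simp only [Matrix.mulVec_smul]
    calc _ = c • (-(cx Cᵀ *ᵥ x) - cx B *ᵥ y) := by
          simp only [smul_sub, smul_smul, smul_neg]
          congr 3
          field_simp
      _ = _ := by rw [h2, smul_smul, smul_smul, mul_comm]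
  · have key : ∀ {m : Type} [Fintype m] (v : m → ℂ),
        star (c • v) ⬝ᵥ (c • v) = c * c * (star v ⬝ᵥ v) := by
      intro m _ v
      rw [star_smul, smul_dotProduct, dotProduct_smul, hcc, smul_smul, smul_eq_mul]
    rw [key, key, star_dotProduct_self_eq, star_dotProduct_self_eq, ← hc, ← mul_add]
    simp only [E, Complex.ofReal_add]

theorem IsScaledEigenpair.norm_le {δ : ℝ} {l : ℂ} {x : Fin d₁ → ℂ} {y : Fin d₂ → ℂ}
    (h : IsScaledEigenpair A B C δ l x y) : ‖x‖ ≤ 1 ∧ ‖y‖ ≤ 1 := by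
  have h1 := h.normalized
  rw [star_dotProduct_self_eq, star_dotProduct_self_eq] at h1
  have h2 : ∑ i, ‖x i‖ ^ 2 + ∑ i, ‖y i‖ ^ 2 = 1 := by exact_mod_cast h1
  have e1 : 0 ≤ ∑ i, ‖x i‖ ^ 2 := Finset.sum_nonneg fun _ _ => sq_nonneg _
  have e2 : 0 ≤ ∑ i, ‖y i‖ ^ 2 := Finset.sum_nonneg fun _ _ => sq_nonneg _
  refine ⟨(pi_norm_le_iff_of_nonneg zero_le_one).2 fun i => ?_,
    (pi_norm_le_iff_of_nonneg zero_le_one).2 fun i => ?_⟩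
  · have := Finset.single_le_sum (f := fun i => ‖x i‖ ^ 2) (fun _ _ => sq_nonneg _)
      (Finset.mem_univ i)
    nlinarith [norm_nonneg (x i)]
  · have := Finset.single_le_sum (f := fun i => ‖y i‖ ^ 2) (fun _ _ => sq_nonneg _)
      (Finset.mem_univ i)
    nlinarith [norm_nonneg (y i)]

/-- The skew part of the matrix drops out of the real part of an eigenvalue. -/
theorem IsScaledEigenpair.re_eq {δ : ℝ} {l : ℂ} {x : Fin d₁ → ℂ} {y : Fin d₂ → ℂ}
    (h : IsScaledEigenpair A B C δ l x y) :
    l.re = δ ^ 2 * (star x ⬝ᵥ (cx A *ᵥ x)).re - (star y ⬝ᵥ (cx B *ᵥ y)).re := by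
  have h1 := congrArg (star x ⬝ᵥ ·) h.eq_fst
  have h2 := congrArg (star y ⬝ᵥ ·) h.eq_snd
  simp only [dotProduct_add, dotProduct_sub, dotProduct_neg, dotProduct_smul, smul_eq_mul] at h1 h2
  rw [star_dotProduct_cx_mulVec Cᵀ, Matrix.transpose_transpose] at h2
  have h3 : l = (δ : ℂ) ^ 2 * (star x ⬝ᵥ (cx A *ᵥ x)) + δ * (star x ⬝ᵥ (cx C *ᵥ y)) +
      (-(δ * conj (star x ⬝ᵥ (cx C *ᵥ y))) - star y ⬝ᵥ (cx B *ᵥ y)) := by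
    rw [h1, h2, ← mul_add, h.normalized, mul_one]
  have h4 := congrArg Complex.re h3
  rw [← Complex.ofReal_pow] at h4
  simp only [Complex.add_re, Complex.sub_re, Complex.neg_re, Complex.re_ofReal_mul,
    Complex.conj_re] at h4
  linarith


/-! ### The limiting eigenvalue problem -/

variable {A : Matrix (Fin d₁) (Fin d₁) ℝ} {B : Matrix (Fin d₂) (Fin d₂) ℝ}
  {C : Matrix (Fin d₁) (Fin d₂) ℝ}

theorem cx_mulVec_mulVec {l m n : Type*} [Fintype m] [Fintype n] (M : Matrix l m ℝ)
    (N : Matrix m n ℝ) (v : n → ℂ) : cx M *ᵥ (cx N *ᵥ v) = cx (M * N) *ᵥ v := by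
  rw [Matrix.mulVec_mulVec, cx, cx, cx, Matrix.map_mul]

theorem star_cx_mulVec_dotProduct {m n : Type*} [Fintype m] [Fintype n] (M : Matrix m n ℝ)
    (v : n → ℂ) (u : m → ℂ) : star (cx M *ᵥ v) ⬝ᵥ u = star v ⬝ᵥ (cx Mᵀ *ᵥ u) := by
  have h : (cx M)ᴴ = cx Mᵀ := by ext; simp
  rw [Matrix.star_mulVec, h, ← Matrix.dotProduct_mulVec]

theorem cx_sub_mulVec {m n : Type*} [Fintype n] (M N : Matrix m n ℝ) (v : n → ℂ) :
    cx (M - N) *ᵥ v = cx M *ᵥ v - cx N *ᵥ v := by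
  rw [← Matrix.sub_mulVec]
  congr 1
  ext
  simp

theorem cx_one_mulVec {n : Type*} [Fintype n] [DecidableEq n] (v : n → ℂ) :
    cx (1 : Matrix n n ℝ) *ᵥ v = v := by
  rw [cx, Matrix.map_one _ (map_zero _) (map_one _), Matrix.one_mulVec]

theorem cx_pinv_mulVec_eq_zero (hB : B.IsSymm) {y : Fin d₂ → ℂ} (hy : cx B *ᵥ y = 0) :
    cx (pinv B) *ᵥ y = 0 := by
  have h := (isMoorePenrose_pinv hB).mul_mul_right
  rw [← h, Matrix.mul_assoc, ← pinv_mul_comm hB, ← cx_mulVec_mulVec, ← cx_mulVec_mulVec, hy]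
  simp

/-- A solution of the limiting problem: an eigenvector of the skew matrix
`[[0, Γ], [-Γᵀ, 0]]` for the eigenvalue `κ`. -/
structure IsLimitEigenpair (B : Matrix (Fin d₂) (Fin d₂) ℝ)
    (C : Matrix (Fin d₁) (Fin d₂) ℝ) (κ : ℂ) (x : Fin d₁ → ℂ) (y : Fin d₂ → ℂ) : Prop where
  mem_ker : cx B *ᵥ y = 0
  eq_fst : cx C *ᵥ y = κ • x
  eq_snd : cx (1 - B * pinv B) *ᵥ (cx Cᵀ *ᵥ x) = -κ • y
  normalized : star x ⬝ᵥ x + star y ⬝ᵥ y = 1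

/-- Pairing the equations with `x` and `y` and using the normalization writes `κ` as a number minus
its conjugate. -/
theorem IsLimitEigenpair.re_eq_zero (hB : B.IsSymm) {κ : ℂ} {x : Fin d₁ → ℂ} {y : Fin d₂ → ℂ}
    (h : IsLimitEigenpair B C κ x y) : κ.re = 0 := by
  have h1 := congrArg (star x ⬝ᵥ ·) h.eq_fst
  have h2 := congrArg (star y ⬝ᵥ ·) h.eq_snd
  simp only [dotProduct_smul, smul_eq_mul] at h1 h2
  have h3 : star y ⬝ᵥ (cx (1 - B * pinv B) *ᵥ (cx Cᵀ *ᵥ x)) = conj (star x ⬝ᵥ (cx C *ᵥ y)) := by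
    rw [cx_sub_mulVec, cx_one_mulVec, dotProduct_sub, star_dotProduct_cx_mulVec Cᵀ,
      Matrix.transpose_transpose, ← cx_mulVec_mulVec, star_dotProduct_cx_mulVec B, hB.eq,
      h.mem_ker]
    simp
  have h4 : κ = star x ⬝ᵥ (cx C *ᵥ y) - conj (star x ⬝ᵥ (cx C *ᵥ y)) := by
    rw [← h3, h1, h2, neg_mul, sub_neg_eq_add, ← mul_add, h.normalized, mul_one]
  rw [h4]
  simp

/-- If `κ = 0`, then `By = 0` and `Cy = 0` force `y = 0`, while `Cᵀx` lies in `range B`, where the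
Schur form is definite; `hθ` then forces `x = 0`, against the normalization. -/
theorem IsLimitEigenpair.ne_zero (hB : B.IsSymm) (hJ : (saddleMatrix A B C 1).det ≠ 0)
    (hS : (restrictedSchur A B C).PosSemidef) {κ : ℂ} {x : Fin d₁ → ℂ} {y : Fin d₂ → ℂ}
    (h : IsLimitEigenpair B C κ x y)
    (hθ : (star x ⬝ᵥ (cx (A - C * pinv B * Cᵀ) *ᵥ x)).re ≤ 0) : κ ≠ 0 := by
  rintro rfl
  have hy : y = 0 := by
    refine (saddleMatrix_kernel_cx hJ (x := 0) ?_ ?_).2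
    · rw [h.eq_fst]; simp
    · rw [h.mem_ker]; simp
  have h1 : cx (B * pinv B) *ᵥ (cx Cᵀ *ᵥ x) = cx Cᵀ *ᵥ x := by
    have := h.eq_snd
    rw [cx_sub_mulVec, cx_one_mulVec, neg_zero, zero_smul, sub_eq_zero] at this
    exact this.symm
  have hre := schur_pos_of_posSemidef hB hJ hS (x := fun i => (x i).re) (by
    rw [← re_cx_mulVec Cᵀ, ← re_cx_mulVec, h1])
  have him := schur_pos_of_posSemidef hB hJ hS (x := fun i => (x i).im) (by
    rw [← im_cx_mulVec Cᵀ, ← im_cx_mulVec, h1])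
  rw [re_star_dotProduct_cx_mulVec] at hθ
  have hx : x = 0 := funext fun i => Complex.ext
    (congrFun (hre.2 (le_antisymm (by linarith [him.1]) hre.1)) i)
    (congrFun (him.2 (le_antisymm (by linarith [hre.1]) him.1)) i)
  have := h.normalized
  simp [hx, hy] at this

/-- Eliminating `x` leaves an equation for `y` with real coefficients, satisfied by the real and
imaginary parts of `y`, one of which is nonzero. -/
theorem IsLimitEigenpair.mem_gammaSingularValues (hB : B.IsSymm) {ω : ℝ} (hω : ω ≠ 0)
    {x : Fin d₁ → ℂ} {y : Fin d₂ → ℂ} (h : IsLimitEigenpair B C (Complex.I * ω) x y) :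
    |ω| ∈ gammaSingularValues B C := by
  have hκ : Complex.I * (ω : ℂ) ≠ 0 := mul_ne_zero Complex.I_ne_zero (by exact_mod_cast hω)
  have hy : y ≠ 0 := by
    rintro rfl
    have h1 := h.eq_fst
    rw [Matrix.mulVec_zero] at h1
    have hx : x = 0 := (smul_eq_zero.1 h1.symm).resolve_left hκ
    have := h.normalized
    simp [hx] at this
  have h2 : cx (1 - B * pinv B) *ᵥ (cx Cᵀ *ᵥ (cx C *ᵥ y)) = ((ω ^ 2 : ℝ) : ℂ) • y := by
    rw [h.eq_fst, Matrix.mulVec_smul, Matrix.mulVec_smul, h.eq_snd, smul_smul]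
    congr 1
    push_cast
    linear_combination (-(ω : ℂ) ^ 2) * Complex.I_mul_I
  by_cases hre : (fun i => (y i).re) = 0
  · have him : (fun i => (y i).im) ≠ 0 := fun h0 =>
      hy (funext fun i => Complex.ext (congrFun hre i) (congrFun h0 i))
    refine abs_mem_gammaSingularValues hB him ?_ ?_
    · rw [← im_cx_mulVec, h.mem_ker]; rfl
    · rw [← im_cx_mulVec, ← im_cx_mulVec, ← im_cx_mulVec, h2]
      funext i
      simp [-Complex.ofReal_pow]
  · refine abs_mem_gammaSingularValues hB hre ?_ ?_
    · rw [← re_cx_mulVec, h.mem_ker]; rfl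
    · rw [← re_cx_mulVec, ← re_cx_mulVec, ← re_cx_mulVec, h2]
      funext i
      simp [-Complex.ofReal_pow]

/-- Limits, along an ultrafilter `δ → 0+`, of eigenvalues `l` with `Re l + s |l|² ≤ 0`. -/
theorem exists_limit_of_bad_eigenvalues {α : Type*} (hB : B.IsSymm)
    (hBneg : (-B).PosSemidef) (hJ : (saddleMatrix A B C 1).det ≠ 0)
    (hS : (restrictedSchur A B C).PosSemidef) {s : ℝ} (hs : 0 < s) (U : Ultrafilter α)
    {δ : α → ℝ} {l : α → ℂ} {l₀ : ℂ} (hδ : Tendsto δ U (𝓝[>] 0)) (hl : Tendsto l U (𝓝 l₀))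
    (hspec : ∀ᶠ a in (U : Filter α), l a ∈ spectrum ℂ (cx (saddleMatrix A B C (δ a ^ 2))))
    (hbad : ∀ᶠ a in (U : Filter α), (l a).re + s * Complex.normSq (l a) ≤ 0) :
    l₀ = 0 ∧ ∃ ω θ : ℝ, ω ≠ 0 ∧ |ω| ∈ gammaSingularValues B C ∧
      Tendsto (fun a => l a / δ a) U (𝓝 (Complex.I * ω)) ∧
      Tendsto (fun a => (l a).re / δ a ^ 2) U (𝓝 θ) ∧ θ + s * ω ^ 2 ≤ 0 := by
  have hδ0 : Tendsto δ U (𝓝 0) := hδ.mono_right nhdsWithin_le_nhds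
  have hδpos : ∀ᶠ a in (U : Filter α), 0 < δ a := hδ self_mem_nhdsWithin
  have hex : ∀ a, ∃ x y, 0 < δ a → l a ∈ spectrum ℂ (cx (saddleMatrix A B C (δ a ^ 2))) →
      IsScaledEigenpair A B C (δ a) (l a) x y := fun a => by
    by_cases h : 0 < δ a ∧ l a ∈ spectrum ℂ (cx (saddleMatrix A B C (δ a ^ 2)))
    · obtain ⟨x, y, hxy⟩ := exists_isScaledEigenpair h.1 h.2
      exact ⟨x, y, fun _ _ => hxy⟩
    · exact ⟨0, 0, fun h1 h2 => absurd ⟨h1, h2⟩ h⟩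
  choose x y hxy using hex
  have hpair : ∀ᶠ a in (U : Filter α), IsScaledEigenpair A B C (δ a) (l a) (x a) (y a) := by
    filter_upwards [hδpos, hspec] with a h1 h2 using hxy a h1 h2
  obtain ⟨x₀, hx⟩ := U.exists_tendsto_of_eventually_norm_le (f := x) (K := 1)
    (hpair.mono fun a h => h.norm_le.1)
  obtain ⟨y₀, hy⟩ := U.exists_tendsto_of_eventually_norm_le (f := y) (K := 1)
    (hpair.mono fun a h => h.norm_le.2)
  have hδc : Tendsto (fun a => (δ a : ℂ)) U (𝓝 0) := by
    have := (Complex.continuous_ofReal.tendsto 0).comp hδ0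
    rwa [Complex.ofReal_zero] at this
  have hnorm : star x₀ ⬝ᵥ x₀ + star y₀ ⬝ᵥ y₀ = 1 := by
    refine tendsto_nhds_unique ((tendsto_star_dotProduct hx hx).add (tendsto_star_dotProduct hy hy))
      (tendsto_const_nhds.congr' ?_)
    filter_upwards [hpair] with a h using h.normalized.symm
  have hlx : l₀ • x₀ = 0 := by
    have h1 := ((hδc.pow 2).smul (tendsto_mulVec (cx A) hx)).add
      (hδc.smul (tendsto_mulVec (cx C) hy))
    rw [zero_pow two_ne_zero, zero_smul, zero_smul, add_zero] at h1
    refine tendsto_nhds_unique ((hl.smul hx).congr' ?_) h1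
    filter_upwards [hpair] with a h using h.eq_fst.symm
  have hly : l₀ • y₀ = -(cx B *ᵥ y₀) := by
    have h1 := (hδc.smul (tendsto_mulVec (cx Cᵀ) hx)).neg.sub (tendsto_mulVec (cx B) hy)
    rw [zero_smul, neg_zero, zero_sub] at h1
    refine tendsto_nhds_unique ((hl.smul hy).congr' ?_) h1
    filter_upwards [hpair] with a h using h.eq_snd.symm
  have hBnn : ∀ v, (star v ⬝ᵥ (cx B *ᵥ v)).re ≤ 0 := fun v => by
    have h1 := re_star_dotProduct_cx_nonneg hBneg v
    have h2 : cx (-B) = -cx B := by ext; simp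
    rw [h2, Matrix.neg_mulVec, dotProduct_neg, Complex.neg_re] at h1
    linarith
  -- A nonzero limit forces `x₀ = 0` and `l₀ = -y₀*By₀`, which has nonnegative real part, against
  -- `Re l₀ + s|l₀|² ≤ 0`.
  have hl₀ : l₀ = 0 := by
    by_contra hne
    have hx0 : x₀ = 0 := (smul_eq_zero.1 hlx).resolve_left hne
    have h1 : l₀.re + s * Complex.normSq l₀ ≤ 0 :=
      le_of_tendsto (((Complex.continuous_re.tendsto _).comp hl).add
        (((Complex.continuous_normSq.tendsto _).comp hl).const_mul s)) hbad
    have h2 : l₀ = -(star y₀ ⬝ᵥ (cx B *ᵥ y₀)) := by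
      rw [hx0] at hnorm
      simp only [dotProduct_zero, zero_add] at hnorm
      rw [← dotProduct_neg, ← hly, dotProduct_smul, hnorm, smul_eq_mul, mul_one]
    have h3 : 0 ≤ l₀.re := by
      rw [h2, Complex.neg_re]; linarith [hBnn y₀]
    have h4 := mul_pos hs (Complex.normSq_pos.2 hne)
    linarith
  refine ⟨hl₀, ?_⟩
  subst hl₀
  have hBy : cx B *ᵥ y₀ = 0 := by
    rw [zero_smul] at hly
    exact neg_eq_zero.1 hly.symm
  -- boundedness of `l / δ`
  have hAx : Tendsto (fun a => (star (x a) ⬝ᵥ (cx A *ᵥ x a)).re) U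
      (𝓝 (star x₀ ⬝ᵥ (cx A *ᵥ x₀)).re) :=
    (Complex.continuous_re.tendsto _).comp (tendsto_star_dotProduct hx (tendsto_mulVec (cx A) hx))
  -- As `-B ⪰ 0`, `Re l ≥ δ² Re x*Ax`; hence `s|l|² ≤ -Re l ≤ -δ² Re x*Ax`, and `Re x*Ax` eventually
  -- exceeds its limit minus one.
  obtain ⟨κ, hκ⟩ := U.exists_tendsto_of_eventually_norm_le (f := fun a => l a / δ a)
    (K := √((1 - (star x₀ ⬝ᵥ (cx A *ᵥ x₀)).re) / s)) (by
      filter_upwards [hpair, hδpos, hbad,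
        hAx.eventually (lt_mem_nhds (sub_one_lt (star x₀ ⬝ᵥ (cx A *ᵥ x₀)).re))] with a h1 h2 h3 h4
      refine Real.le_sqrt_of_sq_le ?_
      rw [norm_div, Complex.norm_real, Real.norm_eq_abs, abs_of_pos h2, div_pow,
        div_le_div_iff₀ (by positivity) hs, ← Complex.normSq_eq_norm_sq]
      have h5 := h1.re_eq
      have h6 := hBnn (y a)
      nlinarith [sq_nonneg (δ a), mul_le_mul_of_nonneg_left h4.le (sq_nonneg (δ a))])
  have hCy : cx C *ᵥ y₀ = κ • x₀ := by
    have h1 := (hδc.smul (tendsto_mulVec (cx A) hx)).add (tendsto_mulVec (cx C) hy)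
    rw [zero_smul, zero_add] at h1
    refine tendsto_nhds_unique h1 ((hκ.smul hx).congr' ?_)
    filter_upwards [hpair, hδpos] with a h h2
    have hne : (δ a : ℂ) ≠ 0 := by exact_mod_cast h2.ne'
    have h3 := congrArg (fun v => (δ a : ℂ)⁻¹ • v) h.eq_fst
    simp only [smul_add, smul_smul, inv_mul_cancel₀ hne, one_smul] at h3
    rw [div_eq_inv_mul, ← h3]
    congr 2
    field_simp
  have hBδ : Tendsto (fun a => (δ a : ℂ)⁻¹ • (cx B *ᵥ y a)) U
      (𝓝 (-(κ • y₀) - cx Cᵀ *ᵥ x₀)) := by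
    refine ((hκ.smul hy).neg.sub (tendsto_mulVec (cx Cᵀ) hx)).congr' ?_
    filter_upwards [hpair, hδpos] with a h h2
    have hne : (δ a : ℂ) ≠ 0 := by exact_mod_cast h2.ne'
    have h3 := congrArg (fun v => (δ a : ℂ)⁻¹ • v) h.eq_snd
    simp only [smul_sub, smul_neg, smul_smul, inv_mul_cancel₀ hne, one_smul] at h3
    rw [div_eq_inv_mul, ← h3]
    abel
  have hX := isMoorePenrose_pinv hB
  have hXy := cx_pinv_mulVec_eq_zero hB hBy
  have hproj : cx (1 - B * pinv B) *ᵥ (cx Cᵀ *ᵥ x₀) = -κ • y₀ := by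
    have h1 := tendsto_mulVec (cx (1 - B * pinv B)) hBδ
    -- The projector `1 - B B†` annihilates `B y / δ` for every `a`, hence also its limit.
    have h2 : cx (1 - B * pinv B) *ᵥ (-(κ • y₀) - cx Cᵀ *ᵥ x₀) = 0 := by
      refine tendsto_nhds_unique h1 (tendsto_const_nhds.congr fun a => ?_)
      rw [Matrix.mulVec_smul, cx_mulVec_mulVec, Matrix.sub_mul, Matrix.one_mul, hX.mul_mul_left,
        sub_self]
      simp [cx]
    have h3 : cx (1 - B * pinv B) *ᵥ y₀ = y₀ := by
      rw [cx_sub_mulVec, cx_one_mulVec, ← cx_mulVec_mulVec, hXy, Matrix.mulVec_zero, sub_zero]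
    rw [Matrix.mulVec_sub, Matrix.mulVec_neg, Matrix.mulVec_smul, h3, sub_eq_zero] at h2
    rw [← h2, neg_smul]
  have hlim : IsLimitEigenpair B C κ x₀ y₀ := ⟨hBy, hCy, hproj, hnorm⟩
  -- the limit of `Re l / δ²`
  have hθ : Tendsto (fun a => (l a).re / δ a ^ 2) U
      (𝓝 (star x₀ ⬝ᵥ (cx (A - C * pinv B * Cᵀ) *ᵥ x₀)).re) := by
    have h1 := (Complex.continuous_re.tendsto _).comp
      (tendsto_star_dotProduct hBδ (tendsto_mulVec (cx (pinv B)) hBδ))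
    have h2 : star (-(κ • y₀) - cx Cᵀ *ᵥ x₀) ⬝ᵥ
        (cx (pinv B) *ᵥ (-(κ • y₀) - cx Cᵀ *ᵥ x₀)) =
        star x₀ ⬝ᵥ (cx (C * pinv B * Cᵀ) *ᵥ x₀) := by
      have h3 : cx (pinv B) *ᵥ (-(κ • y₀) - cx Cᵀ *ᵥ x₀) = -(cx (pinv B) *ᵥ (cx Cᵀ *ᵥ x₀)) := by
        rw [Matrix.mulVec_sub, Matrix.mulVec_neg, Matrix.mulVec_smul, hXy]
        simp
      have h4 : ∀ w v : Fin d₂ → ℂ,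
          star w ⬝ᵥ (cx (pinv B) *ᵥ v) = star (cx (pinv B) *ᵥ w) ⬝ᵥ v := fun w v => by
        rw [star_cx_mulVec_dotProduct, (pinv_isSymm hB).eq]
      rw [h3, dotProduct_neg, h4, h3, star_neg, neg_dotProduct, neg_neg, ← h4,
        star_cx_mulVec_dotProduct, Matrix.transpose_transpose, cx_mulVec_mulVec, cx_mulVec_mulVec,
        Matrix.mul_assoc]
    rw [h2] at h1
    have h4 := hAx.sub h1
    rw [cx_sub_mulVec, dotProduct_sub, Complex.sub_re]
    refine h4.congr' ?_
    filter_upwards [hpair, hδpos] with a h h5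
    have hne : (δ a : ℂ) ≠ 0 := by exact_mod_cast h5.ne'
    -- Since `B B† B = B`, `y*By = (By)*B†(By)`. Dividing by `δ²` leaves a form in `By/δ`, whose
    -- limit is known even though `y/δ` need not converge.
    have h6 : star (y a) ⬝ᵥ (cx B *ᵥ y a) =
        star (cx B *ᵥ y a) ⬝ᵥ (cx (pinv B) *ᵥ (cx B *ᵥ y a)) := by
      rw [star_cx_mulVec_dotProduct, hB.eq, cx_mulVec_mulVec, cx_mulVec_mulVec,
        hX.mul_mul_left]
    rw [h.re_eq, h6]
    simp only [Function.comp, Matrix.mulVec_smul, star_smul, smul_dotProduct, dotProduct_smul,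
      smul_eq_mul]
    have h7 : ∀ q : ℂ, (δ a : ℂ)⁻¹ * (star ((δ a : ℂ)⁻¹) * q) = ((δ a ^ 2)⁻¹ : ℝ) * q := by
      intro q
      have : star ((δ a : ℂ)⁻¹) = (δ a : ℂ)⁻¹ := by
        rw [← Complex.ofReal_inv]; exact Complex.conj_ofReal _
      rw [this]
      push_cast
      ring
    rw [h7, Complex.re_ofReal_mul]
    field_simp
  have hω : κ = Complex.I * (κ.im : ℂ) := by
    apply Complex.ext <;> simp [hlim.re_eq_zero hB]
  have hθle : (star x₀ ⬝ᵥ (cx (A - C * pinv B * Cᵀ) *ᵥ x₀)).re + s * Complex.normSq κ ≤ 0 := by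
    refine le_of_tendsto (hθ.add (((Complex.continuous_normSq.tendsto _).comp hκ).const_mul s)) ?_
    filter_upwards [hbad, hδpos] with a h1 h2
    simp only [Function.comp, Complex.normSq_div, Complex.normSq_ofReal]
    rw [← sq, mul_div_assoc', ← add_div]
    exact div_nonpos_of_nonpos_of_nonneg h1 (sq_nonneg _)
  -- The limiting inequality supplies the required sign: the Schur form is at most `-s|κ|² ≤ 0`.
  have hκ0 : κ ≠ 0 := hlim.ne_zero hB hJ hS (by
    have := mul_nonneg hs.le (Complex.normSq_nonneg κ)
    linarith)
  have him : κ.im ≠ 0 := fun h => hκ0 (by rw [hω, h]; simp)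
  have hn : Complex.normSq κ = κ.im ^ 2 := by
    rw [Complex.normSq_apply, hlim.re_eq_zero hB]; ring
  refine ⟨κ.im, _, him, ?_, hω ▸ hκ, hθ, hn ▸ hθle⟩
  rw [hω] at hlim
  exact hlim.mem_gammaSingularValues hB him

end Limits

/-! ### Branches of eigenvalues -/

/-- A meromorphic function either blows up or has a punctured limit, so a limit along any finer
nontrivial filter is the full limit. This passes from the ultrafilter to `t → 0+`. -/
theorem _root_.MeromorphicAt.tendsto_of_tendsto {E : Type*} [NormedAddCommGroup E]
    [NormedSpace ℝ E] {f : ℝ → E} (hf : MeromorphicAt f 0) {F : Filter ℝ} [F.NeBot]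
    (hF : F ≤ 𝓝[≠] 0) {c : E} (h : Tendsto f F (𝓝 c)) : Tendsto f (𝓝[≠] 0) (𝓝 c) := by
  rcases lt_or_ge (meromorphicOrderAt f 0) 0 with ho | ho
  · have h1 := (tendsto_cobounded_of_meromorphicOrderAt_neg ho).mono_left hF
    rw [← tendsto_norm_atTop_iff_cobounded] at h1
    exact absurd h1 (not_tendsto_atTop_of_tendsto_nhds h.norm)
  · obtain ⟨c', hc'⟩ := tendsto_nhds_of_meromorphicOrderAt_nonneg hf ho
    rwa [tendsto_nhds_unique h (hc'.mono_left hF)]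

theorem isLittleO_sub_mul_sqrt {lam : ℝ → ℂ} {c : ℂ}
    (h : Tendsto (fun ε => lam ε / ((√ε : ℝ) : ℂ)) (𝓝[>] 0) (𝓝 c)) :
    (fun ε => lam ε - c * ((√ε : ℝ) : ℂ)) =o[𝓝[>] 0] fun ε => √ε := by
  have h1 : (fun ε => lam ε - c * ((√ε : ℝ) : ℂ)) =o[𝓝[>] 0] fun ε => ((√ε : ℝ) : ℂ) := by
    refine (Asymptotics.isLittleO_iff_tendsto' ?_).2 ?_
    · filter_upwards [self_mem_nhdsWithin] with ε hε h0
      exact absurd (by exact_mod_cast h0) (Real.sqrt_pos.2 hε).ne'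
    · have h2 := h.sub_const c
      rw [sub_self] at h2
      refine h2.congr' ?_
      filter_upwards [self_mem_nhdsWithin] with ε hε
      have : ((√ε : ℝ) : ℂ) ≠ 0 := by exact_mod_cast (Real.sqrt_pos.2 hε).ne'
      field_simp
  refine Asymptotics.IsLittleO.of_norm_right ?_
  simpa using h1.norm_right

theorem hasPuiseux_of_analyticAt {g : ℂ → ℂ} (hg : AnalyticAt ℂ g 0) (h0 : g 0 = 0) {p : ℕ}
    (hp : 0 < p) : ∃ α, HasPuiseux (fun ε => g ((ε ^ (1 / (p : ℝ)) : ℝ) : ℂ)) p α := by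
  obtain ⟨P, hP⟩ := hg
  have hsum : ∀ᶠ y in 𝓝 (0 : ℂ), HasSum (fun n => P.coeff n * y ^ n) (g y) := by
    filter_upwards [hP.eventually_hasSum] with y hy
    simpa [FormalMultilinearSeries.apply_eq_prod_smul_coeff, mul_comm] using hy
  refine ⟨fun n => P.coeff n, hp, ?_, ?_⟩
  · have h1 := hP.coeff_zero 1
    rw [h0] at h1
    exact h1
  · have h2 : Tendsto (fun ε : ℝ => ((ε ^ (1 / (p : ℝ)) : ℝ) : ℂ)) (𝓝[>] 0) (𝓝 0) := by
      have := (Complex.continuous_ofReal.tendsto 0).comp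
        ((tendsto_rpow_one_div hp).mono_right nhdsWithin_le_nhds)
      rwa [Complex.ofReal_zero] at this
    filter_upwards [h2.eventually hsum, self_mem_nhdsWithin] with ε h3 hε
    simpa only [rpow_natCast_div hε, Complex.ofReal_pow] using h3

theorem exists_isLeadingReal (p : ℕ) (α : ℕ → ℂ) : ∃ ϱ ξ, IsLeadingReal p α ϱ ξ := by
  classical
  by_cases h : ∃ k, (α k).re ≠ 0
  · exact ⟨_, _, Or.inl ⟨Nat.find h, Nat.find_spec h,
      fun k hk => not_not.1 (Nat.find_min h hk), rfl, rfl⟩⟩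
  · push Not at h
    exact ⟨1, 0, Or.inr ⟨h, rfl, rfl⟩⟩

theorem tendsto_hemicurvature {lam : ℝ → ℂ} {p : ℕ} {α : ℕ → ℂ} {ϱ ξ θ : ℝ} (σ : ℝ)
    (h : HasPuiseux lam p α) (hl : IsLeadingReal p α ϱ ξ)
    (hθ : Tendsto (fun ε => (lam ε).re / ε) (𝓝[>] 0) (𝓝 θ)) :
    Tendsto (fun ε : ℝ => ((ξ * ε ^ (ϱ - 1) / σ ^ 2 : ℝ) : EReal)) (𝓝[>] 0)
      (𝓝 ((θ / σ ^ 2 : ℝ) : EReal)) := by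
  obtain ⟨ρ, hρ, hlam⟩ := h.re_eq_leading_mul hl
  refine (continuous_coe_real_ereal.tendsto _).comp (Tendsto.div_const ?_ _)
  have h1 := hθ.div hρ one_ne_zero
  rw [div_one] at h1
  refine h1.congr' ?_
  filter_upwards [hlam, hρ.eventually (lt_mem_nhds zero_lt_one), self_mem_nhdsWithin]
    with ε h2 h3 h4
  have hε : (0 : ℝ) < ε := h4
  simp only [Pi.div_apply]
  rw [h2, Real.rpow_sub_one hε.ne']
  field_simp

/-- An analytic branch of eigenvalues that frequently satisfies `Re l + s |l|² ≤ 0` has a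
hemicurvature `ι` with `s ≤ -ι`. -/
theorem exists_isHemicurvature_of_frequently_bad {f : Z d₁ d₂ → ℝ} (hf : ContDiff ℝ 2 f)
    {z : Z d₁ d₂} (hBneg : (-hessYY f z).PosSemidef)
    (hJ : (saddleMatrix (hessXX f z) (hessYY f z) (hessXY f z) 1).det ≠ 0)
    (hS : (restrictedSchur (hessXX f z) (hessYY f z) (hessXY f z)).PosSemidef)
    {s : ℝ} (hs : 0 < s) {g : ℂ → ℂ} (hg : AnalyticAt ℂ g 0) {N : ℕ} (hN : N ≠ 0)
    (hspec : ∀ᶠ t in 𝓝[>] (0 : ℝ), g t ∈ spectrum ℂ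
      (cx (saddleMatrix (hessXX f z) (hessYY f z) (hessXY f z) (t ^ (2 * N)))))
    (hbad : ∃ᶠ t : ℝ in 𝓝[>] (0 : ℝ), (g t).re + s * Complex.normSq (g t) ≤ 0) :
    ∃ ι, IsHemicurvature f z ι ∧ (s : EReal) ≤ -ι := by
  have hne : (𝓝[>] (0 : ℝ) ⊓ 𝓟 {t : ℝ | (g t).re + s * Complex.normSq (g t) ≤ 0}).NeBot :=
    frequently_mem_iff_neBot.1 hbad
  -- An ultrafilter converging to `0+` along which the inequality fails throughout.
  let U := Ultrafilter.of (𝓝[>] (0 : ℝ) ⊓ 𝓟 {t : ℝ | (g t).re + s * Complex.normSq (g t) ≤ 0})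
  have hU : (U : Filter ℝ) ≤ 𝓝[>] (0 : ℝ) := (Ultrafilter.of_le _).trans inf_le_left
  have hU0 : (U : Filter ℝ) ≤ 𝓝[≠] (0 : ℝ) := hU.trans (nhdsWithin_mono _ fun t ht => ne_of_gt ht)
  have hUbad : ∀ᶠ t : ℝ in (U : Filter ℝ), (g t).re + s * Complex.normSq (g t) ≤ 0 :=
    (Ultrafilter.of_le _).trans inf_le_right (mem_principal_self _)
  have hgc : Tendsto (fun t : ℝ => g t) (𝓝 0) (𝓝 (g 0)) := by
    have h1 : Tendsto (fun t : ℝ => (t : ℂ)) (𝓝 0) (𝓝 0) := by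
      simpa using Complex.continuous_ofReal.tendsto 0
    exact hg.continuousAt.tendsto.comp h1
  have hpow : ∀ k : ℕ, k ≠ 0 → Tendsto (fun t : ℝ => t ^ k) (𝓝[>] 0) (𝓝[>] 0) := by
    intro k hk
    refine tendsto_nhdsWithin_iff.2 ⟨?_, ?_⟩
    · have : Continuous fun t : ℝ => t ^ k := by fun_prop
      have h1 := this.tendsto 0
      rw [zero_pow hk] at h1
      exact h1.mono_left nhdsWithin_le_nhds
    · filter_upwards [self_mem_nhdsWithin] with t ht using pow_pos (Set.mem_Ioi.1 ht) k
  obtain ⟨hg0, ω, θ, hω, hσ, hlim, hre, hle⟩ := exists_limit_of_bad_eigenvalues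
    (hessYY_isSymm hf z) hBneg hJ hS hs U (δ := fun t => t ^ N) (l := fun t => g t) (l₀ := g 0)
    ((hpow N hN).mono_left hU) (hgc.mono_left (hU.trans nhdsWithin_le_nhds))
    (hU (by filter_upwards [hspec] with t ht; rwa [← pow_mul, mul_comm N 2])) hUbad
  -- the limits hold for `t → 0+` by meromorphy
  have hgR : AnalyticAt ℝ (fun t : ℝ => g t) 0 := by
    have h1 : AnalyticAt ℝ g ((fun t : ℝ => (t : ℂ)) 0) := by
      simpa using hg.restrictScalars (𝕜 := ℝ)
    exact h1.fun_comp (f := fun t : ℝ => (t : ℂ)) (Complex.ofRealCLM.analyticAt 0)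
  have hgre : AnalyticAt ℝ (fun t : ℝ => (g t).re) 0 :=
    AnalyticAt.re_ofReal (x := 0) (by simpa using hg)
  have hlim' : Tendsto (fun t : ℝ => g t / ((t ^ N : ℝ) : ℂ)) (𝓝[>] 0) (𝓝 (Complex.I * ω)) := by
    have hden : AnalyticAt ℝ (fun t : ℝ => ((t ^ N : ℝ) : ℂ)) 0 := by
      have h2 : AnalyticAt ℝ (fun t : ℝ => t ^ N) 0 := analyticAt_id.fun_pow N
      exact (Complex.ofRealCLM.analyticAt _).fun_comp (f := fun t : ℝ => t ^ N) h2
    exact ((hgR.meromorphicAt.div hden.meromorphicAt).tendsto_of_tendsto hU0 hlim).mono_left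
      (nhdsWithin_mono _ fun t ht => ne_of_gt ht)
  have hre' : Tendsto (fun t : ℝ => (g t).re / (t ^ N) ^ 2) (𝓝[>] 0) (𝓝 θ) := by
    have hden : AnalyticAt ℝ (fun t : ℝ => (t ^ N) ^ 2) 0 := (analyticAt_id.fun_pow N).fun_pow 2
    exact ((hgre.meromorphicAt.div hden.meromorphicAt).tendsto_of_tendsto hU0 hre).mono_left
      (nhdsWithin_mono _ fun t ht => ne_of_gt ht)
  -- the eigenvalue function of `ε = t ^ (2 N)`
  have hp : 0 < 2 * N := by omega
  obtain ⟨α, hα⟩ := hasPuiseux_of_analyticAt hg hg0 hp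
  obtain ⟨ϱ, ξ, hlead⟩ := exists_isLeadingReal (2 * N) α
  have hroot := tendsto_rpow_one_div hp
  set lam : ℝ → ℂ := fun ε => g ((ε ^ (1 / ((2 * N : ℕ) : ℝ)) : ℝ) : ℂ) with hlam
  have hpowε : ∀ ε : ℝ, 0 < ε → (ε ^ (1 / ((2 * N : ℕ) : ℝ))) ^ (2 * N) = ε := fun ε hε => by
    rw [← rpow_natCast_div hε, div_self (by exact_mod_cast hp.ne'), Real.rpow_one]
  have hsqrt : ∀ ε : ℝ, 0 < ε → (ε ^ (1 / ((2 * N : ℕ) : ℝ))) ^ N = √ε := fun ε hε => by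
    rw [eq_comm, Real.sqrt_eq_iff_mul_self_eq hε.le (pow_nonneg (Real.rpow_nonneg hε.le _) _),
      ← pow_add, ← two_mul, hpowε ε hε]
  have hlamdiv : Tendsto (fun ε => lam ε / ((√ε : ℝ) : ℂ)) (𝓝[>] 0) (𝓝 (Complex.I * ω)) := by
    refine (hlim'.comp hroot).congr' ?_
    filter_upwards [self_mem_nhdsWithin] with ε hε
    simp only [Function.comp, hlam, hsqrt ε hε]
  have hlamre : Tendsto (fun ε => (lam ε).re / ε) (𝓝[>] 0) (𝓝 θ) := by
    refine (hre'.comp hroot).congr' ?_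
    filter_upwards [self_mem_nhdsWithin] with ε hε
    simp only [Function.comp, hlam]
    rw [← pow_mul, mul_comm N 2, hpowε ε hε]
  have hlittle := isLittleO_sub_mul_sqrt hlamdiv
  refine ⟨((θ / |ω| ^ 2 : ℝ) : EReal), ⟨lam, |ω|, 2 * N, α, ϱ, ξ, ?_, hσ, ?_, hα, hlead,
    tendsto_hemicurvature _ hα hlead hlamre⟩, ?_⟩
  · filter_upwards [hroot.eventually hspec, self_mem_nhdsWithin] with ε h1 hε
    rw [timescaledJacobian_eq hf, complexSpectrum_toEuclideanCLM, one_div_one_div]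
    rwa [hpowε ε hε] at h1
  -- The sign of `ω` decides between the branches `+iσ√ε` and `-iσ√ε`.
  · rcases le_or_gt 0 ω with h | h
    · left
      rw [abs_of_nonneg h]
      simpa [mul_assoc] using hlittle
    · right
      rw [abs_of_neg h]
      simpa [mul_assoc, sub_eq_add_neg] using hlittle
  · rw [← EReal.coe_neg, EReal.coe_le_coe_iff, sq_abs, ← neg_div,
      le_div_iff₀ (by positivity)]
    linarith

/-! ### Puiseux branches of the characteristic polynomial -/

open Polynomial in
/-- The characteristic polynomials of `[[ε A, ε C], [-Cᵀ, -B]]` form an analytic family. -/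
theorem exists_charpoly_family (A : Matrix (Fin d₁) (Fin d₁) ℝ) (B : Matrix (Fin d₂) (Fin d₂) ℝ)
    (C : Matrix (Fin d₁) (Fin d₂) ℝ) :
    ∃ F : ℂ → ℂ[X], AnalyticFamily (d₁ + d₂) F ∧ (∀ t, (F t).Monic) ∧
      (∀ t, (F t).natDegree = d₁ + d₂) ∧
      ∀ ε : ℝ, F ε = (cx (saddleMatrix A B C ε)).charpoly := by
  -- The polynomial variable stands for `ε`, so the coefficients of the characteristic polynomial
  -- are polynomials in `ε`.
  let M : Matrix (Fin d₁ ⊕ Fin d₂) (Fin d₁ ⊕ Fin d₂) ℂ[X] :=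
    Matrix.fromBlocks ((X : ℂ[X]) • (cx A).map Polynomial.C) ((X : ℂ[X]) • (cx C).map Polynomial.C)
      (-(cx C.transpose).map Polynomial.C) (-(cx B).map Polynomial.C)
  have hF : ∀ t : ℂ, M.charpoly.map (evalRingHom t) = (M.map (evalRingHom t)).charpoly :=
    fun t => (Matrix.charpoly_map _ _).symm
  have hdeg : ∀ t, (M.charpoly.map (evalRingHom t)).natDegree = d₁ + d₂ := fun t => by
    rw [hF, Matrix.charpoly_natDegree_eq_dim]
    simp
  refine ⟨fun t => M.charpoly.map (evalRingHom t), ⟨fun k => ?_, fun t => (hdeg t).le⟩,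
    fun t => (Matrix.charpoly_monic M).map _, hdeg, fun ε => ?_⟩
  · simp only [coeff_map, coe_evalRingHom]
    exact (Polynomial.differentiable _).analyticAt 0
  · refine (hF ε).trans ?_
    congr 1
    ext i j
    rcases i with i | i <;> rcases j with j | j <;>
      simp [M, saddleMatrix] <;> ring

/-- After ramification the spectrum consists of the values of finitely many analytic branches, so
one of them must violate the inequality for arbitrarily small parameters. -/
theorem exists_isHemicurvature_of_not_eventuallyOutside {f : Z d₁ d₂ → ℝ} (hf : ContDiff ℝ 2 f)
    {z : Z d₁ d₂} (hBneg : (-hessYY f z).PosSemidef)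
    (hJ : (saddleMatrix (hessXX f z) (hessYY f z) (hessXY f z) 1).det ≠ 0)
    (hS : (restrictedSchur (hessXX f z) (hessYY f z) (hessXY f z)).PosSemidef)
    {s : ℝ} (hs : 0 < s)
    (h : ¬ EventuallyOutside (hessXX f z) (hessYY f z) (hessXY f z) s) :
    ∃ ι, IsHemicurvature f z ι ∧ (s : EReal) ≤ -ι := by
  obtain ⟨F, hFan, hFm, hFd, hFε⟩ :=
    exists_charpoly_family (hessXX f z) (hessYY f z) (hessXY f z)
  obtain ⟨q, hq, S, hS', hfac⟩ := hFan.exists_puiseux_factorization hFm hFd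
  -- A further squaring `ε = t ^ (2 * q)` makes `√ε = t ^ q` an integral power of the parameter.
  have hsq : Tendsto (fun t : ℝ => ((t ^ 2 : ℝ) : ℂ)) (𝓝[>] 0) (𝓝 0) := by
    have : Continuous fun t : ℝ => ((t ^ 2 : ℝ) : ℂ) := by fun_prop
    have h1 := this.tendsto 0
    rw [zero_pow two_ne_zero, Complex.ofReal_zero] at h1
    exact h1.mono_left nhdsWithin_le_nhds
  have hspec : ∀ᶠ t in 𝓝[>] (0 : ℝ), ∀ l : ℂ, l ∈ spectrum ℂ (cx (saddleMatrix (hessXX f z)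
      (hessYY f z) (hessXY f z) (t ^ (2 * q)))) ↔ ∃ g ∈ S, l = g ((t ^ 2 : ℝ) : ℂ) := by
    filter_upwards [hsq.eventually hfac] with t ht l
    rw [← Complex.ofReal_pow, ← pow_mul, hFε] at ht
    rw [Matrix.mem_spectrum_iff_isRoot_charpoly, ht, Polynomial.IsRoot,
      Polynomial.eval_list_prod, List.prod_eq_zero_iff]
    simp only [List.mem_map, List.map_map, Function.comp_def, Polynomial.eval_sub,
      Polynomial.eval_X, Polynomial.eval_C, sub_eq_zero]
  have hfreq : ∃ᶠ t in 𝓝[>] (0 : ℝ), ∃ g ∈ S,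
      (g ((t ^ 2 : ℝ) : ℂ)).re + s * Complex.normSq (g ((t ^ 2 : ℝ) : ℂ)) ≤ 0 := by
    by_contra hcon
    rw [not_frequently] at hcon
    refine h ?_
    have hp : 0 < 2 * q := by omega
    filter_upwards [(tendsto_rpow_one_div hp).eventually (hcon.and hspec), self_mem_nhdsWithin]
      with ε h1 hε l hl
    have hpowε : (ε ^ (1 / ((2 * q : ℕ) : ℝ))) ^ (2 * q) = ε := by
      rw [← rpow_natCast_div hε, div_self (by exact_mod_cast hp.ne'), Real.rpow_one]
    obtain ⟨g, hg, rfl⟩ := (h1.2 l).1 (by rwa [hpowε])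
    by_contra! h2
    exact h1.1 ⟨g, hg, h2⟩
  obtain ⟨g, hgS, hg⟩ : ∃ g ∈ S, ∃ᶠ t in 𝓝[>] (0 : ℝ),
      (g ((t ^ 2 : ℝ) : ℂ)).re + s * Complex.normSq (g ((t ^ 2 : ℝ) : ℂ)) ≤ 0 := by
    by_contra! hcon
    have := (Filter.eventually_all_finite (S.finite_toSet)).2 hcon
    obtain ⟨t, ⟨g, hg, h1⟩, h2⟩ := (hfreq.and_eventually this).exists
    exact (h2 g hg).not_ge h1
  refine exists_isHemicurvature_of_frequently_bad hf hBneg hJ hS hs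
    (AnalyticFamily.analyticAt_comp_pow (hS' g hgS) two_ne_zero) hq ?_ ?_
  · filter_upwards [hspec] with t ht
    rw [ht]
    exact ⟨g, hgS, by push_cast; rfl⟩
  · simpa only [Complex.ofReal_pow] using hg

theorem isStableInftyEG_iff_eventuallyOutside {f : Z d₁ d₂ → ℝ} (hf : ContDiff ℝ 2 f) {L : ℝ}
    {z : Z d₁ d₂} (hbound : ‖fderiv ℝ (saddleGrad f) z‖ ≤ L) (hz : saddleGrad f z = 0)
    {s : ℝ} (hs : 0 < s) (hsL : s * L < 1) :
    IsStableInftyEG f s z ↔ EventuallyOutside (hessXX f z) (hessYY f z) (hessXY f z) s := by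
  rw [isStableInftyEG_iff hf hbound hz hs hsL]
  simp only [timescaledJacobian_eq hf, complexSpectrum_toEuclideanCLM, one_div_one_div]
  rfl

end TwoTimescaleEG

end

/-! ### The stability criterion -/

theorem mainTheorem1 (d₁ d₂ : ℕ) (f : TwoTimescaleEG.Z d₁ d₂ → ℝ) (hf : ContDiff ℝ 2 f)
    (L : ℝ) (hL : 0 < L)
    (hbound : ∀ z, ‖fderiv ℝ (TwoTimescaleEG.saddleGrad f) z‖ ≤ L)
    (zstar : TwoTimescaleEG.Z d₁ d₂) (hz : TwoTimescaleEG.saddleGrad f zstar = 0)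
    (hinv : IsUnit (fderiv ℝ (TwoTimescaleEG.saddleGrad f) zstar)) :
    ((TwoTimescaleEG.restrictedSchur (TwoTimescaleEG.hessXX f zstar)
          (TwoTimescaleEG.hessYY f zstar) (TwoTimescaleEG.hessXY f zstar)).PosSemidef ∧
        (-TwoTimescaleEG.hessYY f zstar).PosSemidef ∧
        TwoTimescaleEG.sZero f zstar < ((1 / L : ℝ) : EReal)) ↔
      ∃ sstar : ℝ, 0 < sstar ∧ sstar < 1 / L ∧
        ∀ s : ℝ, sstar < s → s < 1 / L → TwoTimescaleEG.IsStableInftyEG f s zstar := by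
  have hA := TwoTimescaleEG.hessXX_isSymm hf zstar
  have hB := TwoTimescaleEG.hessYY_isSymm hf zstar
  have hb := hbound zstar
  have hJ : (TwoTimescaleEG.saddleMatrix (TwoTimescaleEG.hessXX f zstar)
      (TwoTimescaleEG.hessYY f zstar) (TwoTimescaleEG.hessXY f zstar) 1).det ≠ 0 := by
    rw [TwoTimescaleEG.fderiv_saddleGrad hf] at hinv
    have := hinv.map (Matrix.toEuclideanCLM (n := Fin d₁ ⊕ Fin d₂) (𝕜 := ℝ)).symm
    rw [StarAlgEquiv.symm_apply_apply, Matrix.isUnit_iff_isUnit_det] at this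
    exact this.ne_zero
  have hstab : ∀ s : ℝ, 0 < s → s < 1 / L → (TwoTimescaleEG.IsStableInftyEG f s zstar ↔
      TwoTimescaleEG.EventuallyOutside (TwoTimescaleEG.hessXX f zstar)
        (TwoTimescaleEG.hessYY f zstar) (TwoTimescaleEG.hessXY f zstar) s) := fun s h1 h2 =>
    TwoTimescaleEG.isStableInftyEG_iff_eventuallyOutside hf hb hz h1 ((lt_div_iff₀ hL).1 h2)
  constructor
  · rintro ⟨hS, hBneg, hs₀⟩
    obtain ⟨r, hr1, hr2⟩ := EReal.lt_iff_exists_real_btwn.1 hs₀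
    have hr2' : r < 1 / L := by exact_mod_cast hr2
    have hL' : 0 < 1 / L := by positivity
    -- The real `r` lies strictly between `s₀` and `1 / L`; the maximum with `1 / L / 2` keeps the
    -- threshold positive when `s₀` is negative or `-∞`.
    refine ⟨max r (1 / L / 2), lt_max_of_lt_right (by positivity),
      max_lt hr2' (half_lt_self hL'), fun s hs1 hs2 => ?_⟩
    have hs : 0 < s := (by positivity : 0 < 1 / L / 2).trans ((le_max_right _ _).trans_lt hs1)
    rw [hstab s hs hs2]
    by_contra hcon
    obtain ⟨ι, hι, hsι⟩ := TwoTimescaleEG.exists_isHemicurvature_of_not_eventuallyOutside hf hBneg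
      hJ hS hs hcon
    have h1 : (s : EReal) ≤ TwoTimescaleEG.sZero f zstar := hsι.trans (le_sSup ⟨ι, hι, rfl⟩)
    have h2 : (s : EReal) < (r : EReal) := h1.trans_lt hr1
    have h3 : s < r := by exact_mod_cast h2
    exact absurd ((le_max_left _ _).trans_lt hs1) h3.not_gt
  · rintro ⟨sstar, h0, h1, h⟩
    -- One stable step size suffices, and `s₀ ≤ s < 1 / L` provides the strict inequality.
    obtain ⟨s, hs1, hs2⟩ := exists_between h1
    have hs : 0 < s := h0.trans hs1
    have hst := h s hs1 hs2
    have hout := (hstab s hs hs2).1 hst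
    have hsL := (lt_div_iff₀ hL).1 hs2
    refine ⟨hout.restrictedSchur_posSemidef hA hB hJ hs,
      hout.neg_posSemidef hB hs hsL (by rwa [TwoTimescaleEG.fderiv_saddleGrad hf] at hb), ?_⟩
    refine lt_of_le_of_lt (sSup_le ?_) (EReal.coe_lt_coe_iff.2 hs2)
    rintro _ ⟨ι, hι, rfl⟩
    exact hι.neg_le (fun σ hσ => TwoTimescaleEG.gammaSingularValues_pos hJ hσ)
      ((TwoTimescaleEG.isStableInftyEG_iff hf hb hz hs hsL).1 hst)
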